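/- Setting. There are $M\ge1$ machines. Machine $i$ has a sample space $\mathcal Z_i$, losses $f_i(\cdot;z)$, $z\in\mathcal Z_i$, on a compact convex set $K\subset\mathbb R^d$ with $\|x-y\|\le D$ for all $x,y\in K$ ($D>0$), and a dataset $\mathcal S_i=(z_{1,i},\dots,z_{n,i})\in\mathcal Z_i^n$, $n\ge1$. For all $i$ and $z\in\mathcal Z_i$ the function $f_i(\cdot;z)$ is differentiable and $G$-Lipschitz on $K$ with $\|\nabla f_i(x;z)\|\le G$, and $\|\nabla f_i(x;z)-\nabla f_i(y;z)\|\le L\|x-y\|$ for $x,y\in K$, where $G,L>0$ (if $K$ has empty interior, $\nabla f_i(x;z)$ may be any gradient of $f_i(\cdot;z)$ at $x$ relative to $K$ that satisfies these bounds). Put $S:=G+2LD$, and let $|\mathcal S|=nM$ be the total number of samples. Algorithm (trusted server). Put $\alpha_t=t$, $\beta_t=1/t$, $\alpha_{1:t}=\sum_{s\le t}\alpha_s$. Given $\rho>0$, use the learning rate $\eta=\frac{D\rho M}{2Sn\sqrt d}$ (read as $0$ if $d=0$) and noise variance $\sigma_Y^2=\frac{4S^2n}{\rho^2M^2}$. Start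 from an arbitrary $w_1=x_1\in K$. In round $t=1,\dots,n$ the server broadcasts $x_t$; machine $i$ computes $d_{t,i}=\nabla f_i(x_t;z_{t,i})+(1-\beta_t)\big(d_{t-1,i}-\nabla f_i(x_{t-1};z_{t,i})\big)$ (so $d_{1,i}=\nabla f_i(x_1;z_{1,i})$) and sends $q_{t,i}=\alpha_td_{t,i}$ to the server; the server forms $q_t=\frac1M\sum_iq_{t,i}$, draws independent Gaussian noise $Y_t\sim\mathcal N(0,\sigma_Y^2I_d)$, added only to this aggregated estimate, and sets $$w_{t+1}=\Pi_K\big(w_t-\eta(q_t+Y_t)\big),\qquad x_{t+1}=\tfrac{\alpha_{1:t}}{\alpha_{1:t+1}}x_t+\tfrac{\alpha_{t+1}}{\alpha_{1:t+1}}w_{t+1}.$$ The output is $x_n$. Theorem. 1. (Privacy.) Neither convexity of the losses nor any assumption on the distribution of the data is needed here. For every $\rho>0$, every $\delta\in(0,1)$ and every machine $i$, with the datasets of the other machines fixed arbitrarily, the map from $\mathcal S_i$ to the query points $(x_1,\dots,x_{n+1})$ is $\big(\frac{\rho^2}2+\rho\sqrt{2\log(1/\delta)},\,\delta\big)$-differentially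 private with respect to changing a single element of $\mathcal S_i$. In particular, for $\delta\in(0,1)$ and $0<\varepsilon\le\log(1/\delta)$, the choice $\rho=\varepsilon/(2\sqrt{\log(1/\delta)})$ makes it $(\varepsilon,\delta)$-differentially private. 2. (Convergence.) Suppose in addition that for each $i$ the samples in $\mathcal S_i$ are i.i.d. from a distribution $\mathcal D_i$ on $\mathcal Z_i$, independently across machines, where the $\mathcal D_i$ may be equal (homogeneous case) or different (heterogeneous case); that $f_i(\cdot;z)$ is convex on $K$ for $\mathcal D_i$-almost every $z$ and $f_i(x;\cdot)$ is $\mathcal D_i$-integrable for $x\in K$; and that, with $f_i(x)=\mathbb E_{z\sim\mathcal D_i}f_i(x;z)$ and constants $\sigma,\sigma_L\ge0$, for all $i$ and $x,y\in K$, $$\mathbb E\|\nabla f_i(x;z)-\nabla f_i(x)\|^2\le\sigma^2,\qquad \mathbb E\|(\nabla f_i(x;z)-\nabla f_i(x))-(\nabla f_i(y;z)-\nabla f_i(y))\|^2\le\sigma_L^2\|x-y\|^2.$$ Let $f=\frac1M\sum_if_i$, let $x^*$ be a minimizer of $f$ over $K$, and put $G^*=\|\nabla f(x^*)\|$, $\tilde\sigma=\sigma+2\sigma_LD$.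 Then for every $\rho>0$ $$\mathbb E f(x_n)-\min_Kf\le4D\left(\frac{G^*+2LD}{n}+\frac{\tilde\sigma}{\sqrt{nM}}+\frac{S\sqrt d}{\rho nM}\right),$$ the expectation being over the data and the noise. In particular, if $M\le n$, $\delta\in(0,1)$, $0<\varepsilon\le\log(1/\delta)$ and $\rho=\varepsilon/(2\sqrt{\log(1/\delta)})$, then $$\mathbb E f(x_n)-\min_Kf\le4D\left(\frac{S+\tilde\sigma}{\sqrt{nM}}+\frac{2S\sqrt{d\log(1/\delta)}}{\varepsilon nM}\right)=O\left(\frac1{\sqrt{nM}}+\frac{\sqrt{d\log(1/\delta)}}{\varepsilon nM}\right).$$ 3. (Computation.) The $n$ rounds use exactly $2nM$ stochastic gradient evaluations, $n$ projections onto $K$, $n$ Gaussian draws, and at most $8nM$ linear combinations of two vectors of $\mathbb R^d$, hence a number of operations linear in $|\mathcal S|$. -/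

import Mathlib

open MeasureTheory ProbabilityTheory

/-- The space `ℝ^d` with its Euclidean norm. -/
abbrev Vec (d : ℕ) : Type := EuclideanSpace ℝ (Fin d)

/-- Euclidean projection onto `K`: a point of `K` nearest to `v` (it exists and is unique when `K`
is nonempty, closed and convex). -/
noncomputable def euclProj {d : ℕ} (K : Set (Vec d)) (v : Vec d) : Vec d :=
  Classical.epsilon (fun y => y ∈ K ∧ ∀ u ∈ K, ‖v - y‖ ≤ ‖v - u‖)

/-- The Gaussian distribution `N(0, v • I)` on `ℝ^d`. -/
noncomputable def isoGaussian (d : ℕ) (v : NNReal) : Measure (Vec d) :=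
  (Measure.pi (fun _ : Fin d => gaussianReal 0 v)).map (WithLp.toLp 2)

/-! ### Computations with a unit-cost operation count -/

/-- The elementary operations that are counted: evaluating one stochastic gradient `∇f_i(x; z)`,
projecting one vector onto `K`, drawing one Gaussian vector, and forming one linear combination
of two vectors. -/
inductive Op : Type
  | grad
  | project
  | draw
  | vec
  deriving DecidableEq

/-- A value together with the number of operations of each kind spent on computing it. -/
structure Counted (α : Type) : Type where
  val : α
  cost : Op → ℕ

namespace Counted

/-- Sequential composition adds the costs. -/
instance : Monad Counted where
  pure a := ⟨a, 0⟩
  bind c k := ⟨(k c.val).val, c.cost + (k c.val).cost⟩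

/-- Perform one computation per machine; the costs of all machines are added up. -/
def forMachines {M : ℕ} {α : Type} (c : Fin M → Counted α) : Counted (Fin M → α) :=
  ⟨fun i => (c i).val, ∑ i, (c i).cost⟩

/-- One evaluation of a gradient oracle. -/
def evalGrad {d : ℕ} {Z : Type*} (g : Vec d → Z → Vec d) (x : Vec d) (z : Z) : Counted (Vec d) :=
  ⟨g x z, Pi.single Op.grad 1⟩

/-- One projection onto `K`. -/
noncomputable def project {d : ℕ} (K : Set (Vec d)) (v : Vec d) : Counted (Vec d) :=
  ⟨euclProj K v, Pi.single Op.project 1⟩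

/-- One draw of a noise vector; `y` is the outcome of the draw. -/
def drawNoise {d : ℕ} (y : Vec d) : Counted (Vec d) :=
  ⟨y, Pi.single Op.draw 1⟩

/-- One linear combination `a u + b v`. -/
noncomputable def lin {d : ℕ} (a : ℝ) (u : Vec d) (b : ℝ) (v : Vec d) : Counted (Vec d) :=
  ⟨a • u + b • v, Pi.single Op.vec 1⟩

/-- The sum of `M` vectors, at the price of `M` vector operations. -/
noncomputable def sumAll {d M : ℕ} (v : Fin M → Vec d) : Counted (Vec d) :=
  ⟨∑ i, v i, Pi.single Op.vec M⟩

end Counted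

/-! ### The federated algorithm with a trusted server -/

/-- Importance weights `α_t = t`. -/
def alphaW (t : ℕ) : ℝ := t

/-- Accumulated weights `α_{1:t} = α_1 + ⋯ + α_t`. -/
def alphaSum (t : ℕ) : ℝ := ∑ s ∈ Finset.Icc 1 t, alphaW s

/-- Corrected momentum weights `β_t = 1 / α_t`. -/
noncomputable def betaW (t : ℕ) : ℝ := 1 / alphaW t

/-- What is stored at the beginning of round `t`: the iterate `w_t`, the query point `x_t`, the
previous query point `x_{t-1}`, and the previous estimates `d_{t-1,i}` of the machines. -/
structure FLState (d M : ℕ) : Type where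
  w : Vec d
  x : Vec d
  xPrev : Vec d
  est : Fin M → Vec d

section Algorithm

variable {d M n : ℕ} {Z : Fin M → Type*}

/-- Initialization `w_1 = x_1`. The values chosen for `x_0` and `d_{0,i}` are irrelevant since they
are multiplied by `1 - β_1 = 0` in round `1`. -/
def initState (x₁ : Vec d) : FLState d M := ⟨x₁, x₁, x₁, fun _ => 0⟩

/-- The computation of machine `i` in round `t`, on its `t`-th sample `z`:
`d_{t,i} = ∇f_i(x_t; z) + (1 - β_t) (d_{t-1,i} - ∇f_i(x_{t-1}; z))` and `q_{t,i} = α_t d_{t,i}`.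
The result is the pair `(d_{t,i}, q_{t,i})`. -/
noncomputable def machineStep {Zi : Type*} (g : Vec d → Zi → Vec d) (t : ℕ)
    (x xPrev dPrev : Vec d) (z : Zi) : Counted (Vec d × Vec d) := do
  let gNew ← Counted.evalGrad g x z
  let gOld ← Counted.evalGrad g xPrev z
  let diff ← Counted.lin 1 dPrev (-1) gOld
  let dNew ← Counted.lin 1 gNew (1 - betaW t) diff
  let q ← Counted.lin (alphaW t) dNew 0 dNew
  pure (dNew, q)

/-- Round `t`. All machines compute their estimates on their `t`-th samples `z i`. The server
averages, `q_t = (1/M) ∑ i, q_{t,i}`, draws the noise `Y_t` (with outcome `y`), and updates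
`w_{t+1} = Π_K (w_t - η (q_t + Y_t))` and
`x_{t+1} = (α_{1:t} / α_{1:t+1}) x_t + (α_{t+1} / α_{1:t+1}) w_{t+1}`. -/
noncomputable def flRound (K : Set (Vec d)) (g : ∀ i, Vec d → Z i → Vec d) (η : ℝ) (t : ℕ)
    (z : ∀ i, Z i) (y : Vec d) (s : FLState d M) : Counted (FLState d M) := do
  let r ← Counted.forMachines (fun i => machineStep (g i) t s.x s.xPrev (s.est i) (z i))
  let total ← Counted.sumAll (fun i => (r i).2)
  let q ← Counted.lin (1 / (M : ℝ)) total 0 total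
  let noise ← Counted.drawNoise y
  let u ← Counted.lin 1 q 1 noise
  let v ← Counted.lin 1 s.w (-η) u
  let wNew ← Counted.project K v
  let xNew ← Counted.lin (alphaSum t / alphaSum (t + 1)) s.x
    (alphaW (t + 1) / alphaSum (t + 1)) wNew
  pure ⟨wNew, xNew, s.x, fun i => (r i).1⟩

/-- The state after the rounds `1, …, k`, i.e. at the beginning of round `k + 1`, for the datasets
`S i = (z_{1,i}, …, z_{n,i})` and the noise outcomes `Y = (Y_1, …, Y_n)`. -/
noncomputable def runRounds (K : Set (Vec d)) (g : ∀ i, Vec d → Z i → Vec d) (x₁ : Vec d) (η : ℝ)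
    (S : ∀ i, Fin n → Z i) (Y : Fin n → Vec d) : (k : ℕ) → k ≤ n → Counted (FLState d M)
  | 0, _ => pure (initState x₁)
  | k + 1, hk => do
      let s ← runRounds K g x₁ η S Y k (Nat.le_of_succ_le hk)
      flRound K g η (k + 1) (fun i => S i ⟨k, hk⟩) (Y ⟨k, hk⟩) s

/-- All query points `x_1, …, x_{n+1}` that the server computes (position `k` holds `x_{k+1}`). -/
noncomputable def queryPoints (K : Set (Vec d)) (g : ∀ i, Vec d → Z i → Vec d) (x₁ : Vec d) (η : ℝ)
    (S : ∀ i, Fin n → Z i) (Y : Fin n → Vec d) : Fin (n + 1) → Vec d :=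
  fun k => (runRounds K g x₁ η S Y k (Nat.le_of_lt_succ k.isLt)).val.x

/-- The output `x_n` of the algorithm. -/
noncomputable def flOutput (K : Set (Vec d)) (g : ∀ i, Vec d → Z i → Vec d) (x₁ : Vec d) (η : ℝ)
    (S : ∀ i, Fin n → Z i) (Y : Fin n → Vec d) : Vec d :=
  (runRounds K g x₁ η S Y (n - 1) (Nat.sub_le n 1)).val.x

/-- The number of operations used by the complete run of `n` rounds. -/
noncomputable def flCost (K : Set (Vec d)) (g : ∀ i, Vec d → Z i → Vec d) (x₁ : Vec d) (η : ℝ)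
    (S : ∀ i, Fin n → Z i) (Y : Fin n → Vec d) : Op → ℕ :=
  (runRounds K g x₁ η S Y n le_rfl).cost

end Algorithm

/-- Variance `σ_Y² = 4 S² n / (ρ² M²)` of each coordinate of the injected noise. -/
noncomputable def noiseVar (M n : ℕ) (S ρ : ℝ) : NNReal :=
  Real.toNNReal (4 * S ^ 2 * n / (ρ ^ 2 * M ^ 2))

/-- Learning rate `η = D ρ M / (2 S n √d)`. -/
noncomputable def learningRate (d M n : ℕ) (D S ρ : ℝ) : ℝ :=
  D * ρ * M / (2 * S * n * √d)

/-- Joint law of the independent noise vectors `Y_1, …, Y_n`. -/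
noncomputable def noiseLaw (d M n : ℕ) (S ρ : ℝ) : Measure (Fin n → Vec d) :=
  Measure.pi (fun _ => isoGaussian d (noiseVar M n S ρ))

/-! ### Differential privacy -/

/-- Ordered datasets that differ in (at most) a single element. -/
def Neighbouring {n : ℕ} {Z : Type*} (S S' : Fin n → Z) : Prop :=
  ∃ j, ∀ k, k ≠ j → S k = S' k

/-- `(ε, δ)`-differential privacy of a randomized algorithm `A` whose internal randomness has
law `μ`. -/
def IsDP {n : ℕ} {Z Ω X : Type*} [MeasurableSpace Ω] [MeasurableSpace X] (μ : Measure Ω)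
    (A : (Fin n → Z) → Ω → X) (ε δ : ℝ) : Prop :=
  ∀ S S' : Fin n → Z, Neighbouring S S' → ∀ O : Set X, MeasurableSet O →
    μ {ω | A S ω ∈ O} ≤ ENNReal.ofReal (Real.exp ε) * μ {ω | A S' ω ∈ O} + ENNReal.ofReal δ

/-- Differential privacy for each machine with respect to the query points of the server: whatever
the data of the other machines, the map from the dataset of machine `i` to the query points is
`(ε, δ)`-differentially private. -/
def IsDPForEachMachine {d M n : ℕ} {Z : Fin M → Type*} (K : Set (Vec d))
    (g : ∀ i, Vec d → Z i → Vec d) (x₁ : Vec d) (η : ℝ) (μ : Measure (Fin n → Vec d))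
    (ε δ : ℝ) : Prop :=
  ∀ (i : Fin M) (S : ∀ i, Fin n → Z i),
    IsDP μ (fun Si Y => queryPoints K g x₁ η (Function.update S i Si) Y) ε δ

/-! ### The population objective -/

section Population

variable {d M : ℕ} {Z : Fin M → Type*} [∀ i, MeasurableSpace (Z i)]

/-- The joint objective `f(x) = (1/M) ∑ i, E f_i(x; z^i)`, with `z^i` distributed as `𝒟 i`. -/
noncomputable def popLoss (f : ∀ i, Vec d → Z i → ℝ) (𝒟 : ∀ i, Measure (Z i)) (x : Vec d) : ℝ :=
  (1 / (M : ℝ)) * ∑ i, ∫ z, f i x z ∂(𝒟 i)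

/-- The gradient `∇f_i(x) = E ∇f_i(x; z^i)` of the expected loss of machine `i`. -/
noncomputable def machineGrad (g : ∀ i, Vec d → Z i → Vec d) (𝒟 : ∀ i, Measure (Z i)) (i : Fin M)
    (x : Vec d) : Vec d :=
  ∫ z, g i x z ∂(𝒟 i)

/-- The gradient `∇f(x) = (1/M) ∑ i, ∇f_i(x)` of the joint objective. -/
noncomputable def popGrad (g : ∀ i, Vec d → Z i → Vec d) (𝒟 : ∀ i, Measure (Z i)) (x : Vec d) :
    Vec d :=
  (1 / (M : ℝ)) • ∑ i, machineGrad g 𝒟 i x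

/-- Joint law of the data (`n` independent samples from `𝒟 i` for each machine `i`, independently
across machines) and of the independent noise. -/
noncomputable def dataNoiseLaw (n : ℕ) (𝒟 : ∀ i, Measure (Z i)) (μ : Measure (Fin n → Vec d)) :
    Measure ((∀ i, Fin n → Z i) × (Fin n → Vec d)) :=
  (Measure.pi (fun i => Measure.pi (fun _ : Fin n => 𝒟 i))).prod μ

end Population

/-! ### Euclidean projection -/

section Projection

variable {d : ℕ} {K : Set (Vec d)}

/-! With weights `α_t = t` and `β_t = 1/t` the recursion for `t d_{t,i}` telescopes: the weighted
estimate of a machine is the sum over `s ≤ t` of the increments `s ∇f_i(x_s; z_s) - (s-1)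
∇f_i(x_{s-1}; z_s)`. Each increment involves a single sample. As `(s-1) ‖x_s - x_{s-1}‖ ≤ 2D`
(`traj_step_le`), it has norm at most `S = G + 2LD`, although its weights grow with `s`. Both main
parts rest on this.

Privacy. Replacing one sample alters one increment, so along a fixed trajectory every `q_t` moves by
at most `2S/M`. Adding this difference to the noise reproduces exactly the same query points
(`traj_noiseShift`). The shift in round `t` depends only on earlier noise, so a change of variables
one coordinate at a time (`IsShiftDensity.lintegral_pi`) gives its density, and a Chernoff bound on
the log-density gives the guarantee (`measure_le_of_adaptive_shift`). The noise variance is chosen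
so that `n (2S/M)²` is `ρ²` times it.

Convergence. The error `q_t - t ∇f(x_t)` is `1/M` times a sum of at most `nM` centred increments.
They are orthogonal in `L²`, since each is centred given the past and the other machines, and each
has second moment at most `(σ + 2 σ_L D)²`. Hence the error has mean norm at most `√(n/M) (σ + 2 σ_L
D)` (`integral_norm_estError_le`). Conditioning is expressed by resampling one coordinate of the
product measure. A deterministic inequality (`weighted_gap_le`) turns these errors and the noise
into a bound on the gap. It combines the anytime online-to-batch conversion, the three-point
inequality of the projected step, and a summation by parts that compares `w_k` with `w_{k+1}`; the
last uses that `t ∇f(x_t)` has bounded increments too. -/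

theorem euclProj_spec (hKc : IsCompact K) (hne : K.Nonempty) (v : Vec d) :
    euclProj K v ∈ K ∧ ∀ u ∈ K, ‖v - euclProj K v‖ ≤ ‖v - u‖ := by
  refine Classical.epsilon_spec (p := fun y => y ∈ K ∧ ∀ u ∈ K, ‖v - y‖ ≤ ‖v - u‖) ?_
  obtain ⟨y, hy, hyv⟩ := hKc.exists_infDist_eq_dist hne v
  refine ⟨y, hy, fun u hu => ?_⟩
  rw [← dist_eq_norm, ← dist_eq_norm, ← hyv]
  exact Metric.infDist_le_dist_of_mem hu

theorem euclProj_mem (hKc : IsCompact K) (hne : K.Nonempty) (v : Vec d) : euclProj K v ∈ K :=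
  (euclProj_spec hKc hne v).1

theorem inner_sub_euclProj_nonpos (hKc : IsCompact K) (hKconv : Convex ℝ K) (hne : K.Nonempty)
    (v : Vec d) {u : Vec d} (hu : u ∈ K) :
    inner ℝ (v - euclProj K v) (u - euclProj K v) ≤ 0 := by
  obtain ⟨hp, hmin⟩ := euclProj_spec hKc hne v
  refine (norm_eq_iInf_iff_real_inner_le_zero hKconv hp).1 ?_ u hu
  have : Nonempty K := ⟨⟨_, hp⟩⟩
  refine le_antisymm (le_ciInf fun w => hmin w w.2) ?_
  exact ciInf_le ⟨0, by rintro _ ⟨w, rfl⟩; positivity⟩ (⟨_, hp⟩ : K)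

theorem euclProj_nonexpansive (hKc : IsCompact K) (hKconv : Convex ℝ K) (hne : K.Nonempty)
    (u v : Vec d) : ‖euclProj K u - euclProj K v‖ ≤ ‖u - v‖ := by
  have h1 := inner_sub_euclProj_nonpos hKc hKconv hne u (euclProj_mem hKc hne v)
  have h2 := inner_sub_euclProj_nonpos hKc hKconv hne v (euclProj_mem hKc hne u)
  set p := euclProj K u
  set q := euclProj K v
  have h3 : ‖p - q‖ ^ 2 ≤ inner ℝ (u - v) (p - q) := by
    have e : inner ℝ (u - v) (p - q) - ‖p - q‖ ^ 2
        = -inner ℝ (u - p) (q - p) - inner ℝ (v - q) (p - q) := by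
      rw [← real_inner_self_eq_norm_sq]
      simp only [inner_sub_left, inner_sub_right]
      ring
    linarith
  have h4 := real_inner_le_norm (u - v) (p - q)
  by_contra! hlt
  nlinarith [norm_nonneg (p - q), norm_nonneg (u - v)]

theorem continuous_euclProj (hKc : IsCompact K) (hKconv : Convex ℝ K) (hne : K.Nonempty) :
    Continuous (euclProj K) :=
  (LipschitzWith.of_dist_le_mul (K := 1) fun u v => by
    simpa [dist_eq_norm] using euclProj_nonexpansive hKc hKconv hne u v).continuous

end Projection

/-! ### Weights -/

theorem alphaSum_eq (t : ℕ) : alphaSum t = t * (t + 1) / 2 := by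
  induction t with
  | zero => simp [alphaSum]
  | succ k ih =>
    rw [alphaSum, Finset.sum_Icc_succ_top (by omega), ← alphaSum, ih, alphaW]
    push_cast
    ring

/-! ### The run of the algorithm on streams of data and noise -/

section Trajectory

variable {d M : ℕ} {Z : Fin M → Type*}

/-- The states of the algorithm on infinite streams `z` of data and `y` of noise. -/
noncomputable def traj (K : Set (Vec d)) (g : ∀ i, Vec d → Z i → Vec d) (x₁ : Vec d) (η : ℝ)
    (z : ℕ → ∀ i, Z i) (y : ℕ → Vec d) : ℕ → FLState d M
  | 0 => initState x₁
  | k + 1 => (flRound K g η (k + 1) (z k) (y k) (traj K g x₁ η z y k)).val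

/-- The increment that round `k + 1` adds to the weighted estimate of machine `i`. -/
noncomputable def estIncr (g : ∀ i, Vec d → Z i → Vec d) (z : ℕ → ∀ i, Z i)
    (s : ℕ → FLState d M) (k : ℕ) (i : Fin M) : Vec d :=
  ((k : ℝ) + 1) • g i (s k).x (z k i) - (k : ℝ) • g i (s k).xPrev (z k i)

/-- The aggregated weighted estimate `q_{k+1}` of the server. -/
noncomputable def aggEst (g : ∀ i, Vec d → Z i → Vec d) (z : ℕ → ∀ i, Z i)
    (s : ℕ → FLState d M) (k : ℕ) : Vec d :=
  (1 / (M : ℝ)) • ∑ i, ∑ j ∈ Finset.range (k + 1), estIncr g z s j i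

variable {K : Set (Vec d)} {g : ∀ i, Vec d → Z i → Vec d} {x₁ : Vec d} {η : ℝ}
  {z : ℕ → ∀ i, Z i} {y : ℕ → Vec d}

theorem traj_xPrev_succ (k : ℕ) :
    (traj K g x₁ η z y (k + 1)).xPrev = (traj K g x₁ η z y k).x := rfl

theorem traj_xPrev (k : ℕ) :
    (traj K g x₁ η z y k).xPrev = (traj K g x₁ η z y (k - 1)).x := by
  cases k <;> rfl

/-- Multiplying the momentum recursion by `k + 1` turns the factor `1 - β_{k+1}` into `k`, which
makes the weighted estimates telescope. -/
theorem traj_est_succ (k : ℕ) (i : Fin M) :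
    ((k : ℝ) + 1) • (traj K g x₁ η z y (k + 1)).est i
      = (k : ℝ) • (traj K g x₁ η z y k).est i + estIncr g z (traj K g x₁ η z y) k i := by
  set s := traj K g x₁ η z y k
  have e : (traj K g x₁ η z y (k + 1)).est i
      = (1 : ℝ) • g i s.x (z k i) + (1 - betaW (k + 1)) •
        ((1 : ℝ) • s.est i + (-1 : ℝ) • g i s.xPrev (z k i)) := rfl
  have hk : ((k : ℝ) + 1) ≠ 0 := by positivity
  have hb : ((k : ℝ) + 1) * (1 - betaW (k + 1)) = k := by
    rw [betaW, alphaW]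
    push_cast
    field_simp
    ring
  rw [e, smul_add, smul_smul _ (1 - betaW (k + 1)), hb, estIncr]
  module

theorem traj_est_eq_sum (k : ℕ) (i : Fin M) :
    (k : ℝ) • (traj K g x₁ η z y k).est i
      = ∑ j ∈ Finset.range k, estIncr g z (traj K g x₁ η z y) j i := by
  induction k with
  | zero => simp
  | succ k ih =>
    rw [Finset.sum_range_succ, ← ih]
    push_cast
    exact traj_est_succ k i

theorem traj_w_succ (k : ℕ) :
    (traj K g x₁ η z y (k + 1)).w = euclProj K ((traj K g x₁ η z y k).w
      - η • (aggEst g z (traj K g x₁ η z y) k + y k)) := by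
  -- The unfolded round, by `rfl`. The zero coefficients come from scalings that are counted as
  -- linear combinations with a dummy second vector.
  have e : (traj K g x₁ η z y (k + 1)).w = euclProj K ((1 : ℝ) • (traj K g x₁ η z y k).w
      + (-η) • ((1 : ℝ) • ((1 / (M : ℝ)) •
        (∑ i, (alphaW (k + 1) • (traj K g x₁ η z y (k + 1)).est i
          + (0 : ℝ) • (traj K g x₁ η z y (k + 1)).est i))
        + (0 : ℝ) • (∑ i, (alphaW (k + 1) • (traj K g x₁ η z y (k + 1)).est i
          + (0 : ℝ) • (traj K g x₁ η z y (k + 1)).est i))) + (1 : ℝ) • y k)) := rfl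
  rw [e, aggEst]
  simp only [alphaW, traj_est_eq_sum, zero_smul, add_zero, one_smul, neg_smul, sub_eq_add_neg]

theorem traj_x_succ (k : ℕ) :
    (traj K g x₁ η z y (k + 1)).x
      = (((k : ℝ) + 1) / (k + 3)) • (traj K g x₁ η z y k).x
        + (2 / ((k : ℝ) + 3)) • (traj K g x₁ η z y (k + 1)).w := by
  have e : (traj K g x₁ η z y (k + 1)).x
      = (alphaSum (k + 1) / alphaSum (k + 1 + 1)) • (traj K g x₁ η z y k).x
        + (alphaW (k + 1 + 1) / alphaSum (k + 1 + 1)) • (traj K g x₁ η z y (k + 1)).w := rfl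
  rw [e, alphaSum_eq, alphaSum_eq, alphaW]
  push_cast
  congr 2 <;> field_simp <;> ring

theorem traj_mem (hKc : IsCompact K) (hKconv : Convex ℝ K) (hx₁ : x₁ ∈ K) (k : ℕ) :
    (traj K g x₁ η z y k).w ∈ K ∧ (traj K g x₁ η z y k).x ∈ K := by
  induction k with
  | zero => exact ⟨hx₁, hx₁⟩
  | succ k ih =>
    have hw : (traj K g x₁ η z y (k + 1)).w ∈ K := by
      rw [traj_w_succ]
      exact euclProj_mem hKc ⟨x₁, hx₁⟩ _
    refine ⟨hw, ?_⟩
    rw [traj_x_succ]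
    exact hKconv ih.2 hw (by positivity) (by positivity) (by field_simp; ring)

theorem traj_xPrev_mem (hKc : IsCompact K) (hKconv : Convex ℝ K) (hx₁ : x₁ ∈ K) (k : ℕ) :
    (traj K g x₁ η z y k).xPrev ∈ K := by
  rw [traj_xPrev]
  exact (traj_mem hKc hKconv hx₁ _).2

/-- The averaging rule moves `x` by the fraction `2 / (k + 3)` of a segment inside `K`, so the
movement decays at the rate at which the weights grow. -/
theorem traj_step_le (hKc : IsCompact K) (hKconv : Convex ℝ K) (hx₁ : x₁ ∈ K) {D : ℝ}
    (hdiam : ∀ x ∈ K, ∀ y ∈ K, ‖x - y‖ ≤ D) (k : ℕ) :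
    (k : ℝ) * ‖(traj K g x₁ η z y k).x - (traj K g x₁ η z y k).xPrev‖ ≤ 2 * D := by
  have hD : 0 ≤ D := (norm_nonneg _).trans (hdiam x₁ hx₁ x₁ hx₁)
  cases k with
  | zero => simpa using hD
  | succ k =>
    have e : (traj K g x₁ η z y (k + 1)).x - (traj K g x₁ η z y k).x
        = (2 / ((k : ℝ) + 3)) •
          ((traj K g x₁ η z y (k + 1)).w - (traj K g x₁ η z y k).x) := by
      rw [traj_x_succ, smul_sub]
      have : ((k : ℝ) + 1) / (k + 3) = 1 - 2 / (k + 3) := by field_simp; ring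
      rw [this]
      module
    have h := hdiam _ (traj_mem (g := g) (η := η) (z := z) (y := y) hKc hKconv hx₁ (k + 1)).1 _
      (traj_mem (g := g) (η := η) (z := z) (y := y) hKc hKconv hx₁ k).2
    rw [traj_xPrev_succ, e, norm_smul, Real.norm_of_nonneg (by positivity), ← mul_assoc]
    refine mul_le_mul ?_ h (norm_nonneg _) (by norm_num)
    push_cast
    rw [← mul_div_assoc, div_le_iff₀ (by positivity)]
    linarith

/-- Causality. It makes the noise shift nonanticipating and lets a fresh sample or noise vector
leave the past unchanged. -/
theorem traj_congr {z' : ℕ → ∀ i, Z i} {y' : ℕ → Vec d} (k : ℕ)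
    (hz : ∀ j < k, z j = z' j) (hy : ∀ j < k, y j = y' j) :
    traj K g x₁ η z y k = traj K g x₁ η z' y' k := by
  induction k with
  | zero => rfl
  | succ k ih =>
    simp only [traj]
    rw [ih (fun j hj => hz j (by omega)) (fun j hj => hy j (by omega)), hz k (by omega),
      hy k (by omega)]

theorem norm_smul_sub_smul_le {E : Type*} [NormedAddCommGroup E] [NormedSpace ℝ E] (k : ℕ)
    (u v : E) : ‖((k : ℝ) + 1) • u - (k : ℝ) • v‖ ≤ ‖u‖ + k * ‖u - v‖ := by
  have e : ((k : ℝ) + 1) • u - (k : ℝ) • v = u + (k : ℝ) • (u - v) := by module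
  rw [e]
  refine (norm_add_le _ _).trans ?_
  rw [norm_smul, Real.norm_of_nonneg (by positivity)]

/-- Write the increment as `φ x + k (φ x - φ x')` and use the bound on the drift of the query
points. With `φ` a sample gradient this is the sensitivity bound; with `φ` the population gradient
it feeds the summation by parts. -/
theorem norm_smul_sub_smul_le_of_lipschitz (hKc : IsCompact K) (hKconv : Convex ℝ K)
    (hx₁ : x₁ ∈ K) {D G L : ℝ} (hL : 0 ≤ L) (hdiam : ∀ x ∈ K, ∀ y ∈ K, ‖x - y‖ ≤ D)
    {E : Type*} [NormedAddCommGroup E] [NormedSpace ℝ E] {φ : Vec d → E}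
    (hG : ∀ x ∈ K, ‖φ x‖ ≤ G) (hφ : ∀ x ∈ K, ∀ y ∈ K, ‖φ x - φ y‖ ≤ L * ‖x - y‖) (k : ℕ) :
    ‖((k : ℝ) + 1) • φ (traj K g x₁ η z y k).x - (k : ℝ) • φ (traj K g x₁ η z y k).xPrev‖
      ≤ G + 2 * L * D := by
  have hx := (traj_mem (g := g) (η := η) (z := z) (y := y) hKc hKconv hx₁ k).2
  have hp := traj_xPrev_mem (g := g) (η := η) (z := z) (y := y) hKc hKconv hx₁ k
  refine (norm_smul_sub_smul_le k _ _).trans ?_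
  have h1 := traj_step_le (g := g) (η := η) (z := z) (y := y) hKc hKconv hx₁ hdiam k
  have h2 := mul_le_mul_of_nonneg_left (hφ _ hx _ hp) (Nat.cast_nonneg (α := ℝ) k)
  have h3 := mul_le_mul_of_nonneg_left h1 hL
  have h4 := hG _ hx
  nlinarith

end Trajectory

/-! ### Finite runs -/

section FiniteRun

variable {d M n : ℕ} {Z : Fin M → Type*}

/-- The index `k`, truncated to `Fin n`. -/
def clipIdx (hn : 0 < n) (k : ℕ) : Fin n := ⟨min k (n - 1), by omega⟩

theorem clipIdx_of_lt (hn : 0 < n) {k : ℕ} (hk : k < n) : clipIdx hn k = ⟨k, hk⟩ := by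
  simp only [clipIdx, Fin.mk.injEq]
  omega

/-- The data of all machines as a stream, extended by the last sample. -/
def dataStream (hn : 0 < n) (S : ∀ i, Fin n → Z i) (k : ℕ) : ∀ i, Z i :=
  fun i => S i (clipIdx hn k)

/-- The noise as a stream, extended by the last draw. -/
def noiseStream (hn : 0 < n) (Y : Fin n → Vec d) (k : ℕ) : Vec d := Y (clipIdx hn k)

variable {K : Set (Vec d)} {g : ∀ i, Vec d → Z i → Vec d} {x₁ : Vec d} {η : ℝ}

/-- The padding of the streams is never read in the first `n` rounds. Streams avoid carrying the
proofs of `k ≤ n`. -/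
theorem runRounds_val (hn : 0 < n) (S : ∀ i, Fin n → Z i) (Y : Fin n → Vec d) (k : ℕ)
    (hk : k ≤ n) :
    (runRounds K g x₁ η S Y k hk).val
      = traj K g x₁ η (dataStream hn S) (noiseStream hn Y) k := by
  induction k with
  | zero => rfl
  | succ k ih =>
    have e : (runRounds K g x₁ η S Y (k + 1) hk).val
      = (flRound K g η (k + 1) (fun i => S i ⟨k, hk⟩) (Y ⟨k, hk⟩)
        (runRounds K g x₁ η S Y k (Nat.le_of_succ_le hk)).val).val := rfl
    have e1 : dataStream hn S k = fun i => S i ⟨k, hk⟩ := by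
      funext i
      rw [dataStream, clipIdx_of_lt hn hk]
    have e2 : noiseStream hn Y k = Y ⟨k, hk⟩ := by rw [noiseStream, clipIdx_of_lt hn hk]
    rw [e, ih, traj, e1, e2]

theorem machineStep_cost {Zi : Type*} (g : Vec d → Zi → Vec d) (t : ℕ) (x xPrev dPrev : Vec d)
    (z : Zi) : (machineStep g t x xPrev dPrev z).cost
      = Pi.single Op.grad 2 + Pi.single Op.vec 3 := by
  have e : (machineStep g t x xPrev dPrev z).cost
    = Pi.single Op.grad 1 + (Pi.single Op.grad 1 + (Pi.single Op.vec 1 +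
        (Pi.single Op.vec 1 + (Pi.single Op.vec 1 + 0)))) := rfl
  rw [e]
  funext o
  cases o <;> simp

/-- Vector operations: `3 M` on the machines, `M` for the sum, and four on the server (average,
noise, descent step, query point). -/
theorem flRound_cost (t : ℕ) (z : ∀ i, Z i) (y : Vec d) (s : FLState d M) :
    (flRound K g η t z y s).cost
      = Pi.single Op.grad (2 * M) + Pi.single Op.project 1 + Pi.single Op.draw 1
        + Pi.single Op.vec (4 * M + 4) := by
  have e : (flRound K g η t z y s).cost
    = (∑ i, (machineStep (g i) t s.x s.xPrev (s.est i) (z i)).cost) + (Pi.single Op.vec M +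
      (Pi.single Op.vec 1 + (Pi.single Op.draw 1 + (Pi.single Op.vec 1 + (Pi.single Op.vec 1 +
        (Pi.single Op.project 1 + (Pi.single Op.vec 1 + 0))))))) := rfl
  rw [e]
  simp only [machineStep_cost, Finset.sum_const, Finset.card_univ, Fintype.card_fin]
  funext o
  cases o <;> simp <;> ring

theorem runRounds_cost (S : ∀ i, Fin n → Z i) (Y : Fin n → Vec d) (k : ℕ) (hk : k ≤ n) :
    (runRounds K g x₁ η S Y k hk).cost
      = k • (Pi.single Op.grad (2 * M) + Pi.single Op.project 1 + Pi.single Op.draw 1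
        + Pi.single Op.vec (4 * M + 4)) := by
  induction k with
  | zero => simp; rfl
  | succ k ih =>
    have e : (runRounds K g x₁ η S Y (k + 1) hk).cost
      = (runRounds K g x₁ η S Y k (Nat.le_of_succ_le hk)).cost
        + (flRound K g η (k + 1) (fun i => S i ⟨k, hk⟩) (Y ⟨k, hk⟩)
          (runRounds K g x₁ η S Y k (Nat.le_of_succ_le hk)).val).cost := rfl
    rw [e, ih, flRound_cost, succ_nsmul]

theorem flCost_bounds (hM : 0 < M) (S : ∀ i, Fin n → Z i) (Y : Fin n → Vec d) :
    flCost K g x₁ η S Y Op.grad = 2 * (n * M) ∧ flCost K g x₁ η S Y Op.project = n ∧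
      flCost K g x₁ η S Y Op.draw = n ∧ flCost K g x₁ η S Y Op.vec ≤ 8 * (n * M) := by
  rw [flCost, runRounds_cost]
  simp only [Pi.smul_apply, Pi.add_apply, Pi.single_apply, smul_eq_mul]
  refine ⟨by simp; ring, by simp, by simp, ?_⟩
  simp only [reduceCtorEq, if_false, if_true, zero_add]
  calc n * (4 * M + 4) ≤ n * (8 * M) := Nat.mul_le_mul_left _ (by omega)
    _ = 8 * (n * M) := by ring

end FiniteRun

/-! ### Adaptive shifts of product measures -/

section AdaptiveShift

variable {E : Type*}

/-- The value of `h` at position `t` depends only on the earlier coordinates. -/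
def Nonanticipating {n : ℕ} (h : Fin n → (Fin n → E) → E) : Prop :=
  ∀ t Y Y', (∀ s < t, Y s = Y' s) → h t Y = h t Y'

/-- `ℓ h` is the density that undoes the shift of `γ` by `h`. -/
def IsShiftDensity [MeasurableSpace E] [Add E] (γ : Measure E) (ℓ : E → E → ENNReal) : Prop :=
  Measurable (Function.uncurry ℓ) ∧ ∀ (h : E) (ψ : E → ENNReal), Measurable ψ →
    ∫⁻ y, ψ (y + h) * ℓ h y ∂γ = ∫⁻ y, ψ y ∂γ

/-- Split off the first coordinate by Fubini. Once it is frozen, the remaining shifts are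
nonanticipating in the remaining coordinates, so the induction hypothesis applies to the inner
integral. The first shift is a constant, and the defining property of `ℓ` removes it from the outer
one. -/
theorem IsShiftDensity.lintegral_pi [MeasurableSpace E] [Add E] [MeasurableAdd₂ E]
    {γ : Measure E} [SigmaFinite γ] {ℓ : E → E → ENNReal} (hℓ : IsShiftDensity γ ℓ) (n : ℕ) :
    ∀ (h : Fin n → (Fin n → E) → E), (∀ t, Measurable (h t)) → Nonanticipating h →
      ∀ φ : (Fin n → E) → ENNReal, Measurable φ →
        ∫⁻ Y, φ (fun t => Y t + h t Y) * ∏ t, ℓ (h t Y) (Y t) ∂(Measure.pi fun _ => γ)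
          = ∫⁻ Y, φ Y ∂(Measure.pi fun _ => γ) := by
  induction n with
  | zero =>
    intro h _ _ φ _
    refine lintegral_congr fun Y => ?_
    simp only [Finset.univ_eq_empty, Finset.prod_empty, mul_one]
    congr 1
    exact Subsingleton.elim _ _
  | succ n ih =>
    intro h hm hna φ hφ
    have hcons : Measurable (fun p : E × (Fin n → E) => (Fin.cons p.1 p.2 : Fin (n + 1) → E)) := by
      refine measurable_pi_iff.2 fun t => ?_
      refine Fin.cases ?_ (fun t => ?_) t
      · simpa using measurable_fst
      · simp only [Fin.cons_succ]
        exact (measurable_pi_apply t).comp measurable_snd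
    have key : ∀ F : (Fin (n + 1) → E) → ENNReal, Measurable F →
        ∫⁻ Y, F Y ∂(Measure.pi fun _ => γ)
          = ∫⁻ a, ∫⁻ Y, F (Fin.cons a Y) ∂(Measure.pi fun _ => γ) ∂γ := by
      intro F hF
      have hmp := (measurePreserving_piFinSuccAbove (fun _ : Fin (n + 1) => γ) 0).symm
      rw [← hmp.lintegral_comp hF, lintegral_prod]
      · refine lintegral_congr fun a => lintegral_congr fun Y => ?_
        congr 1
        exact Fin.insertNth_zero (α := fun _ => E) a Y
      · exact (hF.comp hmp.measurable).aemeasurable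
    have hshift : Measurable (fun Y : Fin (n + 1) → E => fun t => Y t + h t Y) :=
      measurable_pi_iff.2 fun t => (measurable_pi_apply t).add (hm t)
    have hprod : Measurable (fun Y : Fin (n + 1) → E => ∏ t, ℓ (h t Y) (Y t)) :=
      Finset.measurable_prod _ fun t _ =>
        hℓ.1.comp ((hm t).prodMk (measurable_pi_apply t))
    rw [key (fun Y => φ (fun t => Y t + h t Y) * ∏ t, ℓ (h t Y) (Y t))
      ((hφ.comp hshift).mul hprod), key _ hφ]
    -- A point of `E` is needed to name the constant value of `h 0`.
    rcases isEmpty_or_nonempty E with hE | ⟨⟨e₀⟩⟩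
    · simp [Measure.eq_zero_of_isEmpty γ]
    set h0 : E := h 0 fun _ => e₀
    have hh0 : ∀ Y, h 0 Y = h0 := fun Y => hna 0 _ _ fun s hs => absurd hs (Fin.not_lt_zero s)
    have hinner : ∀ a, ∫⁻ Y, φ (fun t => (Fin.cons a Y : Fin (n + 1) → E) t
          + h t (Fin.cons a Y)) * ∏ t, ℓ (h t (Fin.cons a Y)) ((Fin.cons a Y : Fin (n + 1) → E) t)
          ∂(Measure.pi fun _ => γ)
        = (∫⁻ Y, φ (Fin.cons (a + h0) Y) ∂(Measure.pi fun _ => γ)) * ℓ h0 a := by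
      intro a
      have hconsa : Measurable (fun Y : Fin n → E => (Fin.cons a Y : Fin (n + 1) → E)) :=
        hcons.comp measurable_prodMk_left
      have hconsb : Measurable (fun Y : Fin n → E => (Fin.cons (a + h0) Y : Fin (n + 1) → E)) :=
        hcons.comp measurable_prodMk_left
      rw [← ih (fun t Y => h t.succ (Fin.cons a Y)) (fun t => (hm t.succ).comp hconsa) ?_
        (fun Y => φ (Fin.cons (a + h0) Y)) (hφ.comp hconsb), ← lintegral_mul_const]
      · refine lintegral_congr fun Y => ?_
        rw [Fin.prod_univ_succ]
        simp only [Fin.cons_zero, Fin.cons_succ, hh0]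
        rw [mul_comm (ℓ h0 a), ← mul_assoc]
        congr 3
        funext t
        refine Fin.cases ?_ (fun t => ?_) t
        · simp [hh0]
        · simp
      · refine Measurable.mul ?_ ?_
        · refine (hφ.comp hconsb).comp (measurable_pi_iff.2 fun t => ?_)
          exact (measurable_pi_apply t).add ((hm t.succ).comp hconsa)
        · exact Finset.measurable_prod _ fun t _ =>
            hℓ.1.comp (((hm t.succ).comp hconsa).prodMk (measurable_pi_apply t))
      · intro t Y Y' hY
        refine hna _ _ _ fun s hs => ?_
        revert hs
        refine Fin.cases (fun _ => rfl) (fun s hs => ?_) s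
        simpa using hY s (Fin.succ_lt_succ_iff.1 hs)
    simp_rw [hinner]
    refine hℓ.2 h0 (fun b => ∫⁻ Y, φ (Fin.cons b Y) ∂(Measure.pi fun _ => γ)) ?_
    exact (hφ.comp hcons).lintegral_prod_right'

end AdaptiveShift

/-! ### Gaussian shifts -/

/-- The factor is the ratio of the Gaussian density at `y + h` to that at `y`; translation
invariance of Lebesgue measure does the rest. -/
theorem isShiftDensity_gaussianReal {v : NNReal} (hv : v ≠ 0) :
    IsShiftDensity (gaussianReal 0 v)
      (fun h y => ENNReal.ofReal (Real.exp (-(y * h) / v - h ^ 2 / (2 * v)))) := by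
  refine ⟨by unfold Function.uncurry; fun_prop, fun h ψ hψ => ?_⟩
  have hv' : (v : ℝ) ≠ 0 := by exact_mod_cast hv
  rw [gaussianReal_of_var_ne_zero 0 hv, lintegral_withDensity_eq_lintegral_mul _
    (measurable_gaussianPDF 0 v) (by fun_prop), lintegral_withDensity_eq_lintegral_mul _
    (measurable_gaussianPDF 0 v) hψ]
  conv_rhs => rw [← lintegral_add_right_eq_self _ h]
  refine lintegral_congr fun y => ?_
  simp only [Pi.mul_apply, gaussianPDF, gaussianPDFReal]
  rw [mul_comm (ψ _), ← mul_assoc, ← ENNReal.ofReal_mul (by positivity), mul_assoc, ← Real.exp_add]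
  congr 4
  field_simp
  ring

theorem measurable_toLp_vec (d : ℕ) :
    Measurable (WithLp.toLp 2 : (Fin d → ℝ) → Vec d) :=
  (PiLp.continuous_toLp 2 _).measurable

instance (d : ℕ) (v : NNReal) : IsProbabilityMeasure (isoGaussian d v) :=
  Measure.isProbabilityMeasure_map (measurable_toLp_vec d).aemeasurable

theorem isShiftDensity_isoGaussian (d : ℕ) {v : NNReal} (hv : v ≠ 0) :
    IsShiftDensity (isoGaussian d v)
      (fun h y => ENNReal.ofReal (Real.exp (-(inner ℝ y h) / v - ‖h‖ ^ 2 / (2 * v)))) := by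
  refine ⟨by unfold Function.uncurry; fun_prop, fun h ψ hψ => ?_⟩
  rw [isoGaussian, lintegral_map (by fun_prop) (measurable_toLp_vec d),
    lintegral_map hψ (measurable_toLp_vec d)]
  -- The vector case is the product lemma for the coordinates, with constant shifts.
  rw [← (isShiftDensity_gaussianReal hv).lintegral_pi d (fun t _ => h t)
    (fun t => measurable_const) (fun _ _ _ _ => rfl) (fun Y => ψ (WithLp.toLp 2 Y)) (hψ.comp (measurable_toLp_vec d))]
  refine lintegral_congr fun Y => ?_
  rw [← ENNReal.ofReal_prod_of_nonneg (fun _ _ => by positivity), ← Real.exp_sum]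
  congr 3
  rw [Finset.sum_sub_distrib, ← Finset.sum_div, ← Finset.sum_div, Finset.sum_neg_distrib]
  simp only [EuclideanSpace.norm_sq_eq, PiLp.inner_apply, Real.norm_eq_abs, sq_abs]
  simp [mul_comm]

/-- An adaptive Gaussian mechanism: if the total squared shift is at most `ρ²` times the variance,
events before and after the shift are `(ρ²/2 + ρ √(2 l), exp (-l))`-indistinguishable. -/
theorem measure_le_of_adaptive_shift {d n : ℕ} {v : NNReal} (hv : v ≠ 0)
    (h : Fin n → (Fin n → Vec d) → Vec d) (hm : ∀ t, Measurable (h t)) (hna : Nonanticipating h)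
    {ρ : ℝ} (hρ : 0 < ρ) (hb : ∀ Y, ∑ t, ‖h t Y‖ ^ 2 ≤ ρ ^ 2 * v) {l : ℝ} (hl : 0 ≤ l)
    {B B' : Set (Fin n → Vec d)} (hB : MeasurableSet B) (hB' : MeasurableSet B')
    (hBB' : ∀ Y, (fun t => Y t + h t Y) ∈ B' ↔ Y ∈ B) :
    (Measure.pi fun _ => isoGaussian d v) B
      ≤ ENNReal.ofReal (Real.exp (ρ ^ 2 / 2 + ρ * √(2 * l)))
          * (Measure.pi fun _ => isoGaussian d v) B' + ENNReal.ofReal (Real.exp (-l)) := by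
  set μ : Measure (Fin n → Vec d) := Measure.pi fun _ => isoGaussian d v
  have hv0 : (0 : ℝ) < v := by exact_mod_cast pos_iff_ne_zero.2 hv
  set ε : ℝ := ρ ^ 2 / 2 + ρ * √(2 * l)
  set ip : (Fin n → Vec d) → ℝ := fun Y => ∑ t, inner ℝ (Y t) (h t Y)
  set sq : (Fin n → Vec d) → ℝ := fun Y => ∑ t, ‖h t Y‖ ^ 2
  have hip : Measurable ip := Finset.measurable_sum _ fun t _ =>
    (measurable_pi_apply t).inner (hm t)
  have hsq : Measurable sq := Finset.measurable_sum _ fun t _ => (hm t).norm.pow_const 2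
  -- The density undoing the shift by `c • h`. It is used twice: `c = 1` transports `B'` to `B`, and
  -- `c = -lam` supplies the exponential moment for the Chernoff bound.
  set R : ℝ → (Fin n → Vec d) → ENNReal := fun c Y =>
    ENNReal.ofReal (Real.exp (-(c * ip Y) / v - c ^ 2 * sq Y / (2 * v)))
  have hR : ∀ c, Measurable (R c) := fun c => by fun_prop
  have hshift : ∀ (c : ℝ) (φ : (Fin n → Vec d) → ENNReal), Measurable φ →
      ∫⁻ Y, φ (fun t => Y t + c • h t Y) * R c Y ∂μ = ∫⁻ Y, φ Y ∂μ := by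
    intro c φ hφ
    rw [← (isShiftDensity_isoGaussian d hv).lintegral_pi n (fun t Y => c • h t Y)
      (fun t => (hm t).const_smul c) (fun t Y Y' hY => congrArg (c • ·) (hna t Y Y' hY)) φ hφ]
    refine lintegral_congr fun Y => ?_
    rw [← ENNReal.ofReal_prod_of_nonneg (fun _ _ => by positivity), ← Real.exp_sum]
    congr 3
    rw [Finset.sum_sub_distrib, ← Finset.sum_div, ← Finset.sum_div, Finset.sum_neg_distrib]
    simp only [inner_smul_right, norm_smul, mul_pow, ← Finset.mul_sum, Real.norm_eq_abs, sq_abs]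
    rfl
  have h1 : μ B' = ∫⁻ Y, B.indicator 1 Y * R 1 Y ∂μ := by
    rw [← lintegral_indicator_one hB', ← hshift 1 _ (measurable_one.indicator hB')]
    refine lintegral_congr fun Y => ?_
    congr 1
    have hY := hBB' Y
    simp only [one_smul]
    by_cases hm : Y ∈ B
    · rw [Set.indicator_of_mem hm, Set.indicator_of_mem (hY.2 hm)]; rfl
    · rw [Set.indicator_of_notMem hm, Set.indicator_of_notMem (fun h' => hm (hY.1 h'))]
  set lam : ℝ := √(2 * l) / ρ
  have h2 : ∫⁻ Y, R (-lam) Y ∂μ = 1 := by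
    have := hshift (-lam) 1 measurable_one
    simpa using this
  -- With `a = ip/v` and `b = sq/v`, the privacy loss is `a + b/2`. Where it is at most `ε`, the
  -- first term dominates the indicator. Elsewhere the second does: `lam a - lam² b/2` exceeds `lam
  -- ε - (lam + lam²) ρ²/2 = (lam ρ)²/2 = l`, which is why `lam = √(2l)/ρ`.
  have hpt : ∀ Y, B.indicator (1 : (Fin n → Vec d) → ENNReal) Y
      ≤ ENNReal.ofReal (Real.exp ε) * (B.indicator 1 Y * R 1 Y)
        + ENNReal.ofReal (Real.exp (-l)) * R (-lam) Y := by
    intro Y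
    by_cases hY : Y ∈ B
    swap
    · simp [hY]
    simp only [Set.indicator_of_mem hY, Pi.one_apply, R]
    rw [one_mul (ENNReal.ofReal _)]
    rw [← ENNReal.ofReal_mul (by positivity), ← ENNReal.ofReal_mul (by positivity),
      ← Real.exp_add, ← Real.exp_add]
    set a : ℝ := ip Y / v
    set b : ℝ := sq Y / v
    have hbρ : b ≤ ρ ^ 2 := (div_le_iff₀ hv0).2 (hb Y)
    have e1 : -(1 * ip Y) / v - 1 ^ 2 * sq Y / (2 * v) = -a - b / 2 := by
      simp only [a, b]; field_simp
    have e2 : -(-lam * ip Y) / v - (-lam) ^ 2 * sq Y / (2 * v) = lam * a - lam ^ 2 * b / 2 := by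
      simp only [a, b]; field_simp
    rw [e1, e2]
    have hlam : 0 ≤ lam := by positivity
    rcases le_or_gt (a + b / 2) ε with hle | hlt
    · refine le_trans ?_ le_self_add
      rw [ENNReal.one_le_ofReal]
      exact Real.one_le_exp (by linarith)
    · refine le_trans ?_ le_add_self
      rw [ENNReal.one_le_ofReal]
      refine Real.one_le_exp ?_
      have hs : √(2 * l) = lam * ρ := by simp only [lam]; field_simp
      have hl2 : l = (lam * ρ) ^ 2 / 2 := by
        rw [← hs, Real.sq_sqrt (by positivity)]; ring
      have hε : ε = ρ ^ 2 / 2 + ρ * (lam * ρ) := by simp only [ε]; rw [hs]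
      have h3 : lam * ε ≤ lam * (a + b / 2) := mul_le_mul_of_nonneg_left hlt.le hlam
      have h4 : (lam + lam ^ 2) * b ≤ (lam + lam ^ 2) * ρ ^ 2 :=
        mul_le_mul_of_nonneg_left hbρ (by positivity)
      rw [hε] at h3
      rw [hl2]
      nlinarith
  calc μ B = ∫⁻ Y, B.indicator 1 Y ∂μ := (lintegral_indicator_one hB).symm
    _ ≤ ∫⁻ Y, ENNReal.ofReal (Real.exp ε) * (B.indicator 1 Y * R 1 Y)
        + ENNReal.ofReal (Real.exp (-l)) * R (-lam) Y ∂μ := lintegral_mono hpt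
    _ = _ := by
      rw [lintegral_add_right _ ((hR _).const_mul _), lintegral_const_mul
        _ (f := fun Y => B.indicator 1 Y * R 1 Y) ((measurable_one.indicator hB).mul (hR 1)), lintegral_const_mul _ (hR _), h2, ← h1,
        mul_one]

/-! ### Measurability of the trajectory -/

section Measurability

variable {d M : ℕ} {Z : Fin M → Type*} {K : Set (Vec d)} {g : ∀ i, Vec d → Z i → Vec d}
  {x₁ : Vec d} {η : ℝ} {Ω : Type*} [MeasurableSpace Ω]
  {z : Ω → ℕ → ∀ i, Z i} {y : Ω → ℕ → Vec d}

theorem measurable_estIncr {s : Ω → ℕ → FLState d M} {j : ℕ} (i : Fin M)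
    (hg : ∀ i k (x : Ω → Vec d), Measurable x → (∀ ω, x ω ∈ K) →
      Measurable fun ω => g i (x ω) (z ω k i))
    (hx : Measurable fun ω => (s ω j).x) (hxK : ∀ ω, (s ω j).x ∈ K)
    (hp : Measurable fun ω => (s ω j).xPrev) (hpK : ∀ ω, (s ω j).xPrev ∈ K) :
    Measurable fun ω => estIncr g (z ω) (s ω) j i := by
  have h1 := hg i j _ hx hxK
  have h2 := hg i j _ hp hpK
  exact (h1.const_smul ((j : ℝ) + 1)).sub (h2.const_smul (j : ℝ))

theorem measurable_aggEst {s : Ω → ℕ → FLState d M} {k : ℕ}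
    (h : ∀ i, ∀ j ≤ k, Measurable fun ω => estIncr g (z ω) (s ω) j i) :
    Measurable fun ω => aggEst g (z ω) (s ω) k := by
  have h1 : Measurable fun ω => ∑ i, ∑ j ∈ Finset.range (k + 1), estIncr g (z ω) (s ω) j i :=
    Finset.measurable_sum _ fun i _ => Finset.measurable_sum _ fun j hj =>
      h i j (Nat.lt_succ_iff.1 (Finset.mem_range.1 hj))
  exact h1.const_smul (1 / (M : ℝ))

/-- The hypothesis `hg` is stated for compositions so that it covers both fixed data, where the
sample spaces carry no σ-algebra, and random data. The induction is strong because an aggregated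
estimate sees all earlier query points. -/
theorem measurable_traj (hKc : IsCompact K) (hKconv : Convex ℝ K) (hx₁ : x₁ ∈ K)
    (hy : ∀ k, Measurable fun ω => y ω k)
    (hg : ∀ i k (x : Ω → Vec d), Measurable x → (∀ ω, x ω ∈ K) →
      Measurable fun ω => g i (x ω) (z ω k i)) (k : ℕ) :
    (Measurable fun ω => (traj K g x₁ η (z ω) (y ω) k).w) ∧
      (Measurable fun ω => (traj K g x₁ η (z ω) (y ω) k).x) := by
  induction k using Nat.strong_induction_on with
  | _ k ih =>
    cases k with
    | zero => exact ⟨measurable_const, measurable_const⟩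
    | succ k =>
      have hx : ∀ j ≤ k, Measurable fun ω => (traj K g x₁ η (z ω) (y ω) j).x :=
        fun j hj => (ih j (by omega)).2
      have hagg : Measurable fun ω => aggEst g (z ω) (traj K g x₁ η (z ω) (y ω)) k := by
        refine measurable_aggEst fun i j hj => measurable_estIncr (K := K) i hg (hx j hj)
          (fun ω => (traj_mem hKc hKconv hx₁ j).2) ?_ fun ω => traj_xPrev_mem hKc hKconv hx₁ j
        simp only [traj_xPrev]
        exact hx (j - 1) (by omega)
      have hw : Measurable fun ω => (traj K g x₁ η (z ω) (y ω) (k + 1)).w := by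
        simp only [traj_w_succ]
        have h1 : Measurable fun ω => (traj K g x₁ η (z ω) (y ω) k).w
            - η • (aggEst g (z ω) (traj K g x₁ η (z ω) (y ω)) k + y ω k) :=
          (ih k (by omega)).1.sub ((hagg.add (hy k)).const_smul η)
        exact (continuous_euclProj hKc hKconv ⟨x₁, hx₁⟩).measurable.comp h1
      refine ⟨hw, ?_⟩
      simp only [traj_x_succ]
      exact ((hx k le_rfl).const_smul (((k : ℝ) + 1) / (k + 3))).add
        (hw.const_smul (2 / ((k : ℝ) + 3)))

theorem measurable_estIncr_traj (hKc : IsCompact K) (hKconv : Convex ℝ K) (hx₁ : x₁ ∈ K)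
    (hy : ∀ k, Measurable fun ω => y ω k)
    (hg : ∀ i k (x : Ω → Vec d), Measurable x → (∀ ω, x ω ∈ K) →
      Measurable fun ω => g i (x ω) (z ω k i))
    {z' : Ω → ℕ → ∀ i, Z i}
    (hg' : ∀ i k (x : Ω → Vec d), Measurable x → (∀ ω, x ω ∈ K) →
      Measurable fun ω => g i (x ω) (z' ω k i)) (j : ℕ) (i : Fin M) :
    Measurable fun ω => estIncr g (z' ω) (traj K g x₁ η (z ω) (y ω)) j i := by
  refine measurable_estIncr (K := K) i hg' (measurable_traj hKc hKconv hx₁ hy hg j).2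
    (fun ω => (traj_mem hKc hKconv hx₁ j).2) ?_ fun ω => traj_xPrev_mem hKc hKconv hx₁ j
  simp only [traj_xPrev]
  exact (measurable_traj hKc hKconv hx₁ hy hg _).2

theorem measurable_comp_of_continuousOn {E F : Type*} [TopologicalSpace E] [MeasurableSpace E]
    [OpensMeasurableSpace E] [TopologicalSpace F] [MeasurableSpace F] [BorelSpace F] {A : Set E}
    {φ : E → F} (hφ : ContinuousOn φ A) {x : Ω → E} (hx : Measurable x) (hA : ∀ ω, x ω ∈ A) :
    Measurable fun ω => φ (x ω) :=
  (continuousOn_iff_continuous_domRestrict.1 hφ).measurable.comp (hx.subtype_mk (h := hA))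

theorem continuousOn_of_norm_sub_le {E F : Type*} [NormedAddCommGroup E] [NormedAddCommGroup F]
    {A : Set E} {φ : E → F} {L : ℝ} (hL : 0 ≤ L)
    (h : ∀ x ∈ A, ∀ y ∈ A, ‖φ x - φ y‖ ≤ L * ‖x - y‖) : ContinuousOn φ A :=
  (LipschitzOnWith.of_dist_le_mul (K := ⟨L, hL⟩) fun x hx y hy => by
    rw [dist_eq_norm, dist_eq_norm]
    exact h x hx y hy).continuousOn

end Measurability

/-! ### Privacy -/

section Privacy

variable {d M n : ℕ} {Z : Fin M → Type*} {K : Set (Vec d)} {g : ∀ i, Vec d → Z i → Vec d}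
  {x₁ : Vec d} {η : ℝ}

/-- The noise shift that compensates a change of the data from `z` to `z'`. -/
noncomputable def noiseShift (K : Set (Vec d)) (g : ∀ i, Vec d → Z i → Vec d) (x₁ : Vec d) (η : ℝ)
    (z z' : ℕ → ∀ i, Z i) (y : ℕ → Vec d) (k : ℕ) : Vec d :=
  aggEst g z (traj K g x₁ η z y) k - aggEst g z' (traj K g x₁ η z y) k

theorem aggEst_congr {z : ℕ → ∀ i, Z i} {s s' : ℕ → FLState d M} {k : ℕ}
    (h : ∀ j ≤ k, s j = s' j) : aggEst g z s k = aggEst g z s' k := by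
  simp only [aggEst, estIncr]
  congr 1
  refine Finset.sum_congr rfl fun i _ => Finset.sum_congr rfl fun j hj => ?_
  rw [h j (Nat.lt_succ_iff.1 (Finset.mem_range.1 hj))]

/-- As long as the query points agree, the shift makes `q_t + Y_t` the same in both runs, so the
next iterates agree. Only `w` and `x` coincide; the estimates of the machines may differ. -/
theorem traj_noiseShift (z z' : ℕ → ∀ i, Z i) (y y' : ℕ → Vec d) (N : ℕ)
    (hy : ∀ k < N, y' k = y k + noiseShift K g x₁ η z z' y k) (k : ℕ) (hk : k ≤ N) :
    (traj K g x₁ η z' y' k).w = (traj K g x₁ η z y k).w ∧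
      (traj K g x₁ η z' y' k).x = (traj K g x₁ η z y k).x := by
  induction k using Nat.strong_induction_on with
  | _ k ih =>
    cases k with
    | zero => exact ⟨rfl, rfl⟩
    | succ k =>
      have hagg : aggEst g z' (traj K g x₁ η z' y') k = aggEst g z' (traj K g x₁ η z y) k := by
        simp only [aggEst, estIncr, traj_xPrev]
        congr 1
        refine Finset.sum_congr rfl fun i _ => Finset.sum_congr rfl fun j hj => ?_
        have hj' : j ≤ k := Nat.lt_succ_iff.1 (Finset.mem_range.1 hj)
        rw [(ih j (by omega) (by omega)).2, (ih (j - 1) (by omega) (by omega)).2]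
      have hw : (traj K g x₁ η z' y' (k + 1)).w = (traj K g x₁ η z y (k + 1)).w := by
        rw [traj_w_succ, traj_w_succ, hagg, (ih k (by omega) (by omega)).1, hy k (by omega),
          noiseShift]
        congr 3
        abel
      refine ⟨hw, ?_⟩
      rw [traj_x_succ, traj_x_succ, hw, (ih k (by omega) (by omega)).2]

/-- Both aggregates are taken along the same trajectory, so all increments cancel except the one
that reads the altered sample. -/
theorem norm_noiseShift_le {C : ℝ} (hM : 0 < M) (z z' : ℕ → ∀ i, Z i) (y : ℕ → Vec d)
    (i₀ : Fin M) (j₀ : ℕ) {N : ℕ}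
    (hz : ∀ i j, i ≠ i₀ ∨ j ≠ j₀ → j < N → z j i = z' j i) (hC : 0 ≤ C)
    (hb : ‖estIncr g z (traj K g x₁ η z y) j₀ i₀‖ ≤ C)
    (hb' : ‖estIncr g z' (traj K g x₁ η z y) j₀ i₀‖ ≤ C) (k : ℕ) (hk : k < N) :
    ‖noiseShift K g x₁ η z z' y k‖ ≤ 2 * C / M := by
  have hM' : (0 : ℝ) < M := by exact_mod_cast hM
  have hinc : ∀ i j, i ≠ i₀ ∨ j ≠ j₀ → j ∈ Finset.range (k + 1) →
      estIncr g z (traj K g x₁ η z y) j i - estIncr g z' (traj K g x₁ η z y) j i = 0 := by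
    intro i j hij hj
    rw [estIncr, estIncr, hz i j hij (by rw [Finset.mem_range] at hj; omega), sub_self]
  have hcomp : ‖∑ i, ∑ j ∈ Finset.range (k + 1), (estIncr g z (traj K g x₁ η z y) j i
      - estIncr g z' (traj K g x₁ η z y) j i)‖ ≤ 2 * C := by
    rw [Finset.sum_eq_single i₀ (fun i _ hi => Finset.sum_eq_zero fun j hj => hinc i j (Or.inl hi) hj)
      (fun h => absurd (Finset.mem_univ _) h)]
    by_cases hj : j₀ ∈ Finset.range (k + 1)
    · rw [Finset.sum_eq_single_of_mem j₀ hj fun j hj hj' => hinc i₀ j (Or.inr hj') hj]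
      exact (norm_sub_le _ _).trans (by linarith)
    · rw [Finset.sum_eq_zero fun j hj' => hinc i₀ j (Or.inr fun h => hj (h ▸ hj')) hj', norm_zero]
      linarith
  rw [noiseShift, aggEst, aggEst, ← smul_sub, ← Finset.sum_sub_distrib]
  simp_rw [← Finset.sum_sub_distrib]
  rw [norm_smul, Real.norm_of_nonneg (by positivity), one_div, inv_mul_eq_div]
  gcongr

variable {D G L : ℝ}

theorem queryPoints_isDP (hM : 0 < M) (hn : 0 < n) (hKc : IsCompact K) (hKconv : Convex ℝ K)
    (hG : 0 < G) (hL : 0 < L) (hD : 0 < D) (hdiam : ∀ x ∈ K, ∀ y ∈ K, ‖x - y‖ ≤ D)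
    (hgG : ∀ i z, ∀ x ∈ K, ‖g i x z‖ ≤ G)
    (hsmooth : ∀ i z, ∀ x ∈ K, ∀ y ∈ K, ‖g i x z - g i y z‖ ≤ L * ‖x - y‖)
    (hx₁ : x₁ ∈ K) {S : ℝ} (hS : S = G + 2 * L * D) {ρ : ℝ} (hρ : 0 < ρ) {δ : ℝ} (hδ : 0 < δ)
    (hδ1 : δ < 1) :
    IsDPForEachMachine K g x₁ η (noiseLaw d M n S ρ)
      (ρ ^ 2 / 2 + ρ * √(2 * Real.log (1 / δ))) δ := by
  intro i₀ A T T' hTT' O hO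
  obtain ⟨j₀, hj₀⟩ := hTT'
  have hM' : (0 : ℝ) < M := by exact_mod_cast hM
  have hn' : (0 : ℝ) < n := by exact_mod_cast hn
  have hS0 : 0 < S := by rw [hS]; positivity
  have hvar : (0 : ℝ) < 4 * S ^ 2 * n / (ρ ^ 2 * M ^ 2) := by positivity
  have hv : noiseVar M n S ρ ≠ 0 := (Real.toNNReal_pos.2 hvar).ne'
  set z := dataStream hn (Function.update A i₀ T)
  set z' := dataStream hn (Function.update A i₀ T')
  set h : Fin n → (Fin n → Vec d) → Vec d := fun t Y =>
    noiseShift K g x₁ η z z' (noiseStream hn Y) t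
  have hy : ∀ k, Measurable fun Y : Fin n → Vec d => noiseStream hn Y k :=
    fun k => measurable_pi_apply _
  have hgm : ∀ (z : ℕ → ∀ i, Z i) i k (x : (Fin n → Vec d) → Vec d), Measurable x →
      (∀ ω, x ω ∈ K) → Measurable fun ω => g i (x ω) (z k i) := fun z i k x hx hxK =>
    measurable_comp_of_continuousOn (continuousOn_of_norm_sub_le hL.le (hsmooth i (z k i))) hx hxK
  have hq : ∀ z : ℕ → ∀ i, Z i, Measurable fun Y : Fin n → Vec d => fun k : Fin (n + 1) =>
      (traj K g x₁ η z (noiseStream hn Y) k).x := fun z =>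
    measurable_pi_iff.2 fun k => (measurable_traj hKc hKconv hx₁ hy (hgm z) k).2
  have hquery : ∀ B Y, queryPoints K g x₁ η B Y = fun k : Fin (n + 1) =>
      (traj K g x₁ η (dataStream hn B) (noiseStream hn Y) k).x := by
    intro B Y
    funext k
    rw [queryPoints, runRounds_val hn]
  have hinc : ∀ (z'' : ℕ → ∀ i, Z i) (Y : Fin n → Vec d) j i,
      ‖estIncr g z'' (traj K g x₁ η z (noiseStream hn Y)) j i‖ ≤ S := by
    intro z'' Y j i
    rw [hS]
    exact norm_smul_sub_smul_le_of_lipschitz hKc hKconv hx₁ hL.le hdiam (hgG i (z'' j i))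
      (hsmooth i (z'' j i)) j
  have hsum : ∀ Y, ∑ t, ‖h t Y‖ ^ 2 ≤ ρ ^ 2 * (noiseVar M n S ρ : ℝ) := by
    intro Y
    have hdata : ∀ i j, i ≠ i₀ ∨ j ≠ (j₀ : ℕ) → j < n → z j i = z' j i := by
      intro i j hij hj
      simp only [z, z', dataStream, clipIdx_of_lt hn hj]
      by_cases hi : i = i₀
      · subst hi
        simp only [Function.update_self]
        exact hj₀ ⟨j, hj⟩ fun h => (hij.resolve_left (fun h' => h' rfl)) (congrArg Fin.val h)
      · simp only [Function.update_of_ne hi]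
    have hterm : ∀ t, ‖h t Y‖ ^ 2 ≤ (2 * S / M) ^ 2 := fun t =>
      pow_le_pow_left₀ (norm_nonneg _) (norm_noiseShift_le hM z z' _ i₀ j₀ hdata hS0.le
        (hinc z Y j₀ i₀) (hinc z' Y j₀ i₀) t t.isLt) 2
    -- The noise variance is calibrated to make this an equality: `n (2S/M)² = ρ² σ_Y²`.
    refine (Finset.sum_le_sum fun t _ => hterm t).trans (le_of_eq ?_)
    rw [Finset.sum_const, Finset.card_univ, Fintype.card_fin, nsmul_eq_mul, noiseVar,
      Real.coe_toNNReal _ hvar.le]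
    field_simp
    ring
  have hmh : ∀ t, Measurable (h t) := fun t =>
    (measurable_aggEst fun i j _ => measurable_estIncr_traj hKc hKconv hx₁ hy (hgm z) (hgm z) j
      i).sub (measurable_aggEst fun i j _ => measurable_estIncr_traj hKc hKconv hx₁ hy (hgm z)
      (hgm z') j i)
  have hna : Nonanticipating h := by
    intro t Y Y' hYY'
    have htr : ∀ j ≤ (t : ℕ), traj K g x₁ η z (noiseStream hn Y) j
        = traj K g x₁ η z (noiseStream hn Y') j := fun j hj =>
      traj_congr j (fun _ _ => rfl) fun i hi => by
        have hin : i < n := by omega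
        rw [noiseStream, noiseStream, clipIdx_of_lt hn hin]
        exact hYY' _ (Fin.mk_lt_of_lt_val (by omega))
    simp only [h, noiseShift]
    rw [aggEst_congr htr, aggEst_congr htr]
  have hl : 0 ≤ Real.log (1 / δ) := Real.log_nonneg (by rw [le_div_iff₀ hδ]; linarith)
  have hexp : Real.exp (-Real.log (1 / δ)) = δ := by
    rw [one_div, Real.log_inv, neg_neg, Real.exp_log hδ]
  have hmain := measure_le_of_adaptive_shift hv h hmh hna hρ hsum hl
    (B := {Y | (fun k : Fin (n + 1) => (traj K g x₁ η z (noiseStream hn Y) k).x) ∈ O})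
    (B' := {Y | (fun k : Fin (n + 1) => (traj K g x₁ η z' (noiseStream hn Y) k).x) ∈ O})
    (hq z hO) (hq z' hO) ?_
  · rw [hexp] at hmain
    simp only [hquery]
    exact hmain
  · intro Y
    have : (fun k : Fin (n + 1) =>
        (traj K g x₁ η z' (noiseStream hn fun t => Y t + h t Y) k).x)
        = fun k : Fin (n + 1) => (traj K g x₁ η z (noiseStream hn Y) k).x := by
      funext k
      refine (traj_noiseShift z z' _ _ n (fun j hj => ?_) k (Nat.lt_succ_iff.1 k.isLt)).2
      simp only [noiseStream, clipIdx_of_lt hn hj, h]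
    simp only [Set.mem_ofPred_eq, this]

theorem IsDP.mono {Ω X Zi : Type*} [MeasurableSpace Ω] [MeasurableSpace X] {μ : Measure Ω}
    {A : (Fin n → Zi) → Ω → X} {ε ε' δ : ℝ} (h : IsDP μ A ε δ) (hε : ε ≤ ε') :
    IsDP μ A ε' δ := fun S S' hSS' O hO => (h S S' hSS' O hO).trans (by gcongr)

/-- The two terms are at most `ε/8` and, by `√2 ≤ 3/2`, at most `3ε/4`. -/
theorem privacy_budget_le {ε l ρ : ℝ} (hε : 0 < ε) (hl : ε ≤ l) (hρ : ρ = ε / (2 * √l)) :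
    ρ ^ 2 / 2 + ρ * √(2 * l) ≤ ε := by
  have hl0 : 0 < l := hε.trans_le hl
  have hs : 0 < √l := Real.sqrt_pos.2 hl0
  have hsq : √l ^ 2 = l := Real.sq_sqrt hl0.le
  have h2 : √2 ≤ 3 / 2 := by
    rw [Real.sqrt_le_left (by norm_num)]
    norm_num
  have e1 : ρ ^ 2 / 2 = ε * (ε / l) / 8 := by
    rw [hρ, div_pow, mul_pow, hsq]
    field_simp
    ring
  have e2 : ρ * √(2 * l) = ε * √2 / 2 := by
    rw [hρ, Real.sqrt_mul (by norm_num)]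
    field_simp
  have h3 : ε / l ≤ 1 := (div_le_one hl0).2 hl
  rw [e1, e2]
  nlinarith

end Privacy

/-! ### Resampling one coordinate of a product measure -/

section Resampling

/-- Checked on boxes. Integrating over the fresh coordinate plays the role of conditioning on all
the others. -/
theorem measurePreserving_update {ι : Type*} [Fintype ι] [DecidableEq ι] {X : ι → Type*}
    [∀ i, MeasurableSpace (X i)] (μ : ∀ i, Measure (X i)) [∀ i, IsProbabilityMeasure (μ i)]
    (i : ι) :
    MeasurePreserving (fun p : (∀ j, X j) × X i => Function.update p.1 i p.2)
      ((Measure.pi μ).prod (μ i)) (Measure.pi μ) := by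
  have hm : Measurable fun p : (∀ j, X j) × X i => Function.update p.1 i p.2 :=
    measurable_update'
  refine ⟨hm, (Measure.pi_eq fun s hs => ?_).symm⟩
  rw [Measure.map_apply hm (MeasurableSet.univ_pi hs)]
  have hpre : (fun p : (∀ j, X j) × X i => Function.update p.1 i p.2) ⁻¹' Set.univ.pi s
      = (Set.univ.pi (Function.update s i Set.univ)) ×ˢ s i := by
    ext p
    simp only [Set.mem_preimage, Set.mem_pi, Set.mem_univ, true_implies, Set.mem_prod]
    constructor
    · intro h
      refine ⟨fun j => ?_, by simpa using h i⟩
      by_cases hj : j = i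
      · subst hj; simp
      · simpa [hj] using h j
    · rintro ⟨h1, h2⟩ j
      by_cases hj : j = i
      · subst hj; simpa using h2
      · simpa [hj] using h1 j
  rw [hpre, Measure.prod_prod, Measure.pi_pi, ← Finset.mul_prod_erase _ _ (Finset.mem_univ i),
    ← Finset.mul_prod_erase _ (fun j => μ j (s j)) (Finset.mem_univ i)]
  simp only [Function.update_self, measure_univ, one_mul]
  rw [mul_comm]
  congr 1
  refine Finset.prod_congr rfl fun j hj => ?_
  rw [Function.update_of_ne (Finset.ne_of_mem_erase hj)]

theorem MeasureTheory.MeasurePreserving.update_comp {ι : Type*} [Fintype ι] [DecidableEq ι]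
    {X : ι → Type*} [∀ i, MeasurableSpace (X i)] {μ : ∀ i, Measure (X i)}
    [∀ i, IsProbabilityMeasure (μ i)] {i : ι} {A : Type*} [MeasurableSpace A] {ν : Measure A}
    [SFinite ν] {Φ : X i × A → X i} (hΦ : MeasurePreserving Φ ((μ i).prod ν) (μ i)) :
    MeasurePreserving (fun p : (∀ j, X j) × A => Function.update p.1 i (Φ (p.1 i, p.2)))
      ((Measure.pi μ).prod ν) (Measure.pi μ) := by
  have hm : Measurable fun p : (∀ j, X j) × A => Function.update p.1 i (Φ (p.1 i, p.2)) :=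
    measurable_update'.comp (measurable_fst.prodMk (hΦ.measurable.comp
      (((measurable_pi_apply i).comp measurable_fst).prodMk measurable_snd)))
  have h1 := (measurePreserving_update μ i).comp
    (((MeasurePreserving.id (Measure.pi μ)).prod hΦ).comp
      (measurePreserving_prodAssoc (Measure.pi μ) (μ i) ν))
  have h2 := (measurePreserving_update μ i).prod (MeasurePreserving.id ν)
  refine ⟨hm, ?_⟩
  -- First replace block `i` by an independent copy, which does not change the law. Then `Φ` acts on
  -- that copy, and the original block `i` is overwritten.
  conv_lhs => rw [← h2.map_eq]
  rw [Measure.map_map hm h2.measurable]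
  refine Eq.trans ?_ h1.map_eq
  congr 1
  funext p
  simp [MeasurableEquiv.prodAssoc]

variable {Ω Ω' A : Type*} [MeasurableSpace Ω] [MeasurableSpace Ω'] [MeasurableSpace A]
  {P : Measure Ω} {P' : Measure Ω'} {ν : Measure A}

theorem MeasureTheory.MeasurePreserving.resample_fst [SFinite P] [SFinite P'] [SFinite ν]
    {R : Ω × A → Ω} (hR : MeasurePreserving R (P.prod ν) P) :
    MeasurePreserving (fun p : (Ω × Ω') × A => (R (p.1.1, p.2), p.1.2))
      ((P.prod P').prod ν) (P.prod P') :=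
  (hR.prod (MeasurePreserving.id P')).comp
    ((measurePreserving_prodAssoc P ν P').symm.comp
      (((MeasurePreserving.id P).prod Measure.measurePreserving_swap).comp
        (measurePreserving_prodAssoc P P' ν)))

theorem MeasureTheory.MeasurePreserving.resample_snd [SFinite P] [SFinite P'] [SFinite ν]
    {R : Ω' × A → Ω'} (hR : MeasurePreserving R (P'.prod ν) P') :
    MeasurePreserving (fun p : (Ω × Ω') × A => (p.1.1, R (p.1.2, p.2)))
      ((P.prod P').prod ν) (P.prod P') :=
  ((MeasurePreserving.id P).prod hR).comp (measurePreserving_prodAssoc P P' ν)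

theorem integral_resample [SFinite P] [SFinite ν] {R : Ω × A → Ω}
    (hR : MeasurePreserving R (P.prod ν) P) {W : Ω → ℝ} (hW : Integrable W P) :
    ∫ ω, W ω ∂P = ∫ ω, ∫ a, W (R (ω, a)) ∂ν ∂P := by
  have hi : Integrable (fun p => W (R p)) (P.prod ν) := hR.integrable_comp_of_integrable hW
  rw [← integral_prod _ hi]
  conv_lhs => rw [← hR.map_eq]
  rw [integral_map hR.measurable.aemeasurable]
  rw [hR.map_eq]
  exact hW.aestronglyMeasurable

theorem integral_le_of_resample [IsProbabilityMeasure P] [SFinite ν] {R : Ω × A → Ω}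
    (hR : MeasurePreserving R (P.prod ν) P) {W : Ω → ℝ} (hW : Integrable W P) {c : ℝ}
    (hc : ∀ ω, ∫ a, W (R (ω, a)) ∂ν ≤ c) : ∫ ω, W ω ∂P ≤ c := by
  rw [integral_resample hR hW]
  have hi : Integrable (fun p => W (R p)) (P.prod ν) := hR.integrable_comp_of_integrable hW
  refine (integral_mono hi.integral_prod_left (integrable_const c) hc).trans ?_
  simp

/-- `U` does not see the resampled coordinate and comes out of the inner integral, where `V`
averages to zero. -/
theorem integral_inner_eq_zero_of_resample [SFinite P] [SFinite ν] {E : Type*}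
    [NormedAddCommGroup E] [InnerProductSpace ℝ E] [CompleteSpace E] {R : Ω × A → Ω}
    (hR : MeasurePreserving R (P.prod ν) P) {U V : Ω → E}
    (hUV : Integrable (fun ω => inner ℝ (U ω) (V ω)) P) (hU : ∀ ω a, U (R (ω, a)) = U ω)
    (hVi : ∀ ω, Integrable (fun a => V (R (ω, a))) ν) (hV : ∀ ω, ∫ a, V (R (ω, a)) ∂ν = 0) :
    ∫ ω, inner ℝ (U ω) (V ω) ∂P = 0 := by
  rw [integral_resample hR hUV]
  simp_rw [hU]
  simp [integral_inner (hVi _), hV]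

end Resampling

/-! ### Second moments -/

section SecondMoments

variable {Ω : Type*} [MeasurableSpace Ω] {P : Measure Ω} {E : Type*} [NormedAddCommGroup E]

/-- Minkowski's inequality in `L²`, from `(s + t)² ≤ (A + B)(s²/A + t²/B)`. The slack `e` keeps `A`
and `B` positive when `a` or `b` vanishes. -/
theorem integral_norm_add_sq_le {u v : Ω → E} {a b : ℝ} (ha : 0 ≤ a) (hb : 0 ≤ b)
    (hu : Integrable (fun ω => ‖u ω‖ ^ 2) P) (hv : Integrable (fun ω => ‖v ω‖ ^ 2) P)
    (hua : ∫ ω, ‖u ω‖ ^ 2 ∂P ≤ a ^ 2) (hvb : ∫ ω, ‖v ω‖ ^ 2 ∂P ≤ b ^ 2) :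
    ∫ ω, ‖u ω + v ω‖ ^ 2 ∂P ≤ (a + b) ^ 2 := by
  rw [← Real.sqrt_le_left (by positivity)]
  refine le_of_forall_pos_le_add fun e he => ?_
  rw [Real.sqrt_le_left (by positivity)]
  set A := a + e / 2
  set B := b + e / 2
  have hA : 0 < A := by positivity
  have hB : 0 < B := by positivity
  have hpt : ∀ ω, ‖u ω + v ω‖ ^ 2 ≤ (A + B) * (‖u ω‖ ^ 2 / A + ‖v ω‖ ^ 2 / B) := by
    intro ω
    have h1 : ‖u ω + v ω‖ ^ 2 ≤ (‖u ω‖ + ‖v ω‖) ^ 2 :=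
      pow_le_pow_left₀ (norm_nonneg _) (norm_add_le _ _) 2
    refine h1.trans ?_
    have h2 : (A + B) * (‖u ω‖ ^ 2 / A + ‖v ω‖ ^ 2 / B) - (‖u ω‖ + ‖v ω‖) ^ 2
        = (B * ‖u ω‖ - A * ‖v ω‖) ^ 2 / (A * B) := by
      field_simp
      ring
    have h3 : 0 ≤ (B * ‖u ω‖ - A * ‖v ω‖) ^ 2 / (A * B) := by positivity
    linarith
  have hint : Integrable (fun ω => (A + B) * (‖u ω‖ ^ 2 / A + ‖v ω‖ ^ 2 / B)) P :=
    ((hu.div_const A).add (hv.div_const B)).const_mul _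
  refine (integral_mono_of_nonneg (Filter.Eventually.of_forall fun ω => by positivity) hint
    (Filter.Eventually.of_forall hpt)).trans ?_
  rw [integral_const_mul, integral_add (hu.div_const A) (hv.div_const B), integral_div,
    integral_div]
  have h1 : (∫ ω, ‖u ω‖ ^ 2 ∂P) / A ≤ A := by
    rw [div_le_iff₀ hA]
    refine hua.trans ?_
    rw [← sq]
    exact pow_le_pow_left₀ ha (by simp only [A]; linarith) 2
  have h2 : (∫ ω, ‖v ω‖ ^ 2 ∂P) / B ≤ B := by
    rw [div_le_iff₀ hB]
    refine hvb.trans ?_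
    rw [← sq]
    exact pow_le_pow_left₀ hb (by simp only [B]; linarith) 2
  calc (A + B) * ((∫ ω, ‖u ω‖ ^ 2 ∂P) / A + (∫ ω, ‖v ω‖ ^ 2 ∂P) / B)
      ≤ (A + B) * (A + B) := by gcongr
    _ = (a + b + e) ^ 2 := by simp only [A, B]; ring

theorem integral_norm_sum_sq_le [InnerProductSpace ℝ E] {ι : Type*} [DecidableEq ι]
    (s : Finset ι) {V : ι → Ω → E} {c : ℝ}
    (hint : ∀ i ∈ s, ∀ j ∈ s, Integrable (fun ω => inner ℝ (V i ω) (V j ω)) P)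
    (horth : ∀ i ∈ s, ∀ j ∈ s, i ≠ j → ∫ ω, inner ℝ (V i ω) (V j ω) ∂P = 0)
    (hc : ∀ i ∈ s, ∫ ω, ‖V i ω‖ ^ 2 ∂P ≤ c) :
    ∫ ω, ‖∑ i ∈ s, V i ω‖ ^ 2 ∂P ≤ s.card * c := by
  have e : ∀ ω, ‖∑ i ∈ s, V i ω‖ ^ 2 = ∑ i ∈ s, ∑ j ∈ s, inner ℝ (V i ω) (V j ω) := by
    intro ω
    rw [← real_inner_self_eq_norm_sq, sum_inner]
    simp_rw [inner_sum]
  simp_rw [e]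
  rw [integral_finsetSum _ fun i hi => integrable_finsetSum _ fun j hj => hint i hi j hj]
  rw [← nsmul_eq_mul]
  refine Finset.sum_le_card_nsmul _ _ _ fun i hi => ?_
  rw [integral_finsetSum _ fun j hj => hint i hi j hj,
    Finset.sum_eq_single_of_mem i hi fun j hj hij => horth i hi j hj hij.symm]
  simpa only [real_inner_self_eq_norm_sq] using hc i hi

theorem integral_norm_le_of_sq [IsProbabilityMeasure P] {u : Ω → E} {c : ℝ} (hc : 0 ≤ c)
    (hu : Integrable (fun ω => ‖u ω‖ ^ 2) P) (hu1 : Integrable (fun ω => ‖u ω‖) P)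
    (h : ∫ ω, ‖u ω‖ ^ 2 ∂P ≤ c ^ 2) :
    ∫ ω, ‖u ω‖ ∂P ≤ c := by
  set m := ∫ ω, ‖u ω‖ ∂P
  have h0 : 0 ≤ ∫ ω, (‖u ω‖ - m) ^ 2 ∂P := integral_nonneg fun ω => by positivity
  have e : ∫ ω, (‖u ω‖ - m) ^ 2 ∂P = (∫ ω, ‖u ω‖ ^ 2 ∂P) - m ^ 2 := by
    have e1 : ∀ ω, (‖u ω‖ - m) ^ 2 = (‖u ω‖ ^ 2 - (2 * m) * ‖u ω‖) + m ^ 2 := fun ω => by ring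
    simp_rw [e1]
    rw [integral_add (f := fun ω => ‖u ω‖ ^ 2 - 2 * m * ‖u ω‖) (hu.sub (hu1.const_mul _))
      (integrable_const _),
      integral_sub hu (hu1.const_mul _), integral_const_mul]
    simp only [integral_const, probReal_univ, one_smul]
    change _ - 2 * m * m + _ = _
    ring
  rw [e] at h0
  exact le_of_sq_le_sq (by linarith) hc

end SecondMoments

/-! ### Moments of the isotropic Gaussian -/

section GaussianMoments

variable {d : ℕ} {v : NNReal}

theorem measurePreserving_isoGaussian_apply (t : Fin d) :
    MeasurePreserving (fun y : Vec d => y t) (isoGaussian d v) (gaussianReal 0 v) := by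
  refine ⟨by fun_prop, ?_⟩
  rw [isoGaussian, Measure.map_map (by fun_prop) (measurable_toLp_vec d)]
  exact (measurePreserving_eval (fun _ : Fin d => gaussianReal 0 v) t).map_eq

theorem memLp_isoGaussian_apply (t : Fin d) :
    MemLp (fun y : Vec d => y t) 2 (isoGaussian d v) :=
  (memLp_id_gaussianReal (μ := 0) (v := v) 2).comp_measurePreserving
    (measurePreserving_isoGaussian_apply t)

theorem memLp_id_isoGaussian : MemLp (fun y : Vec d => y) 2 (isoGaussian d v) :=
  MemLp.of_eval_piLp fun t => memLp_isoGaussian_apply t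

theorem integral_id_isoGaussian : ∫ y, y ∂(isoGaussian d v) = 0 := by
  have hi : Integrable (fun y : Vec d => y) (isoGaussian d v) :=
    memLp_id_isoGaussian.integrable (by norm_num)
  ext t
  have h1 := (EuclideanSpace.proj (𝕜 := ℝ) t).integral_comp_comm hi
  have h2 : ∫ y : Vec d, y t ∂(isoGaussian d v) = 0 := by
    have h := measurePreserving_isoGaussian_apply (v := v) t
    have h3 := integral_id_gaussianReal (μ := 0) (v := v)
    rw [← h.map_eq, integral_map h.measurable.aemeasurable (by fun_prop)] at h3
    exact h3
  exact h1.symm.trans h2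

theorem integral_norm_sq_isoGaussian : ∫ y, ‖y‖ ^ 2 ∂(isoGaussian d v) = d * v := by
  have h1 : ∀ t : Fin d, ∫ y : Vec d, (y t) ^ 2 ∂(isoGaussian d v) = v := by
    intro t
    have h := measurePreserving_isoGaussian_apply (v := v) t
    have h3 := variance_eq_integral (μ := gaussianReal 0 v) (X := id) (by fun_prop)
    rw [variance_id_gaussianReal] at h3
    simp only [id_eq, integral_id_gaussianReal, sub_zero] at h3
    rw [h3, ← h.map_eq, integral_map h.measurable.aemeasurable (by fun_prop)]
  simp_rw [EuclideanSpace.norm_sq_eq, Real.norm_eq_abs, sq_abs]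
  rw [integral_finsetSum _ fun t _ => (memLp_isoGaussian_apply t).integrable_sq]
  simp [h1]

end GaussianMoments

/-! ### The regret inequality -/

section Regret

variable {E : Type*} [NormedAddCommGroup E] [InnerProductSpace ℝ E]

/-- The averaging rule expresses `(m + 2)(w_{m+1} - u)` through `x_{m+1} - u` and `x_m - x_{m+1}`.
The first-order inequalities from `x_{m+1}` towards `u` and towards `x_m` then raise the weight on
the gap from `(m+1)(m+2)/2` to `(m+2)(m+3)/2`. -/
theorem anytime_online_to_batch {K : Set E} {F : E → ℝ} {dF : E → E}
    (hF : ∀ u ∈ K, ∀ v ∈ K, F u + inner ℝ (dF u) (v - u) ≤ F v) {x w : ℕ → E}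
    (hx : ∀ k, x k ∈ K) (h0 : x 0 = w 0)
    (hstep : ∀ k : ℕ, x (k + 1) = (((k : ℝ) + 1) / (k + 3)) • x k
      + (2 / ((k : ℝ) + 3)) • w (k + 1)) {u : E} (hu : u ∈ K) (m : ℕ) :
    ((m : ℝ) + 1) * (m + 2) / 2 * (F (x m) - F u)
      ≤ ∑ k ∈ Finset.range (m + 1), ((k : ℝ) + 1) * inner ℝ (dF (x k)) (w k - u) := by
  induction m with
  | zero =>
    have h := hF _ (hx 0) _ hu
    rw [← neg_sub (x 0) u, inner_neg_right] at h
    simp only [Nat.cast_zero, zero_add, Finset.sum_range_one, one_mul]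
    rw [← h0]
    linarith
  | succ m ih =>
    rw [Finset.sum_range_succ]
    set y := x (m + 1)
    have h1 := hF y (hx _) _ hu
    have h2 := hF y (hx _) _ (hx m)
    have hne : ((m : ℝ) + 3) ≠ 0 := by positivity
    have e : ((m : ℝ) + 2) • (w (m + 1) - u)
        = ((m : ℝ) + 2) • (y - u) - (((m : ℝ) + 1) * (m + 2) / 2) • (x m - y) := by
      have hw : w (m + 1) = (((m : ℝ) + 3) / 2) • y - (((m : ℝ) + 1) / 2) • x m := by
        simp only [y]
        rw [hstep, smul_add, smul_smul, smul_smul]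
        have e1 : ((m : ℝ) + 3) / 2 * (((m : ℝ) + 1) / (m + 3)) = ((m : ℝ) + 1) / 2 := by
          field_simp
        have e2 : ((m : ℝ) + 3) / 2 * (2 / ((m : ℝ) + 3)) = 1 := by field_simp
        rw [e1, e2]
        module
      rw [hw]
      module
    have e3 : ((m : ℝ) + 2) * inner ℝ (dF y) (w (m + 1) - u)
        = ((m : ℝ) + 2) * inner ℝ (dF y) (y - u)
          - (((m : ℝ) + 1) * (m + 2) / 2) * inner ℝ (dF y) (x m - y) := by
      rw [← inner_smul_right, e, inner_sub_right, inner_smul_right, inner_smul_right]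
    rw [← neg_sub y u, inner_neg_right] at h1
    have h1' := mul_le_mul_of_nonneg_left h1 (by positivity : (0 : ℝ) ≤ (m : ℝ) + 2)
    have h2' := mul_le_mul_of_nonneg_left h2
      (by positivity : (0 : ℝ) ≤ ((m : ℝ) + 1) * (m + 2) / 2)
    push_cast
    rw [show (m : ℝ) + 1 + 1 = m + 2 by ring, e3]
    nlinarith

theorem sum_inner_increments_le {K : Set E} {D B : ℝ}
    (hdiam : ∀ x ∈ K, ∀ y ∈ K, ‖x - y‖ ≤ D) (hB : 0 ≤ B) {p w : ℕ → E} (hw : ∀ k, w k ∈ K)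
    (hp0 : p 0 = 0) (hp : ∀ k, ‖p (k + 1) - p k‖ ≤ B) (n : ℕ) :
    ∑ k ∈ Finset.range n, inner ℝ (p (k + 1)) (w k - w (k + 1)) ≤ n * (B * D) := by
  -- Summation by parts. The induction carries the boundary term against an arbitrary `u`; taking `u
  -- = w n` at the end removes it.
  have key : ∀ u ∈ K, ∑ k ∈ Finset.range n, inner ℝ (p (k + 1)) (w k - w (k + 1))
      + inner ℝ (p n) (w n - u) ≤ n * (B * D) := by
    induction n with
    | zero => simp [hp0]
    | succ n ih =>
      intro u hu
      have h1 := ih u hu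
      have h2 : inner ℝ (p (n + 1) - p n) (w n - u) ≤ B * D :=
        (real_inner_le_norm _ _).trans
          (mul_le_mul (hp n) (hdiam _ (hw n) _ hu) (norm_nonneg _) hB)
      have h3 : inner ℝ (p (n + 1)) (w n - w (n + 1)) + inner ℝ (p (n + 1)) (w (n + 1) - u)
          = inner ℝ (p n) (w n - u) + inner ℝ (p (n + 1) - p n) (w n - u) := by
        rw [← inner_add_right, ← inner_add_left]
        congr 1 <;> abel
      rw [Finset.sum_range_succ]
      push_cast
      linarith
  simpa using key _ (hw n)

/-- The three-point inequality of a projected step. -/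
theorem inner_le_of_obtuse {η : ℝ} (hη : 0 < η) {a b q u : E}
    (h : inner ℝ ((a - η • q) - b) (u - b) ≤ 0) :
    inner ℝ q (b - u) ≤ (‖a - u‖ ^ 2 - ‖b - u‖ ^ 2 - ‖a - b‖ ^ 2) / (2 * η) := by
  rw [le_div_iff₀ (by positivity)]
  have e : inner ℝ ((a - η • q) - b) (u - b) = inner ℝ (a - b) (u - b) + η * inner ℝ q (b - u) := by
    rw [← neg_sub u b, inner_neg_right]
    simp only [inner_sub_left, inner_smul_left, RCLike.conj_to_real]
    ring
  have e2 : ‖a - u‖ ^ 2 = ‖a - b‖ ^ 2 + ‖b - u‖ ^ 2 - 2 * inner ℝ (a - b) (u - b) := by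
    have : a - u = (a - b) - (u - b) := by abel
    rw [this, norm_sub_sq_real, norm_sub_rev b u]
    ring
  rw [e] at h
  rw [e2]
  linarith

/-- Pairing `q k` with the new point `w (k + 1)` avoids a term `‖q k‖²`. The noise is paired with `w
k`, of which it will be independent; the difference is absorbed by the term `-‖w k - w (k + 1)‖² /
(2η)` of the three-point inequality. -/
theorem noisy_regret_le {K : Set E} {D η : ℝ} (hη : 0 < η) (hdiam : ∀ x ∈ K, ∀ y ∈ K, ‖x - y‖ ≤ D)
    {w q y : ℕ → E} (hw : ∀ k, w k ∈ K)
    (hstep : ∀ k, ∀ u ∈ K, inner ℝ ((w k - η • (q k + y k)) - w (k + 1)) (u - w (k + 1)) ≤ 0)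
    {u : E} (hu : u ∈ K) (n : ℕ) :
    ∑ k ∈ Finset.range n, inner ℝ (q k) (w (k + 1) - u)
      ≤ D ^ 2 / (2 * η) + η / 2 * ∑ k ∈ Finset.range n, ‖y k‖ ^ 2
        - ∑ k ∈ Finset.range n, inner ℝ (w k - u) (y k) := by
  have hpt : ∀ k, inner ℝ (q k) (w (k + 1) - u)
      ≤ (‖w k - u‖ ^ 2 - ‖w (k + 1) - u‖ ^ 2) / (2 * η) + η / 2 * ‖y k‖ ^ 2
        - inner ℝ (w k - u) (y k) := by
    intro k
    have h1 := inner_le_of_obtuse hη (hstep k u hu)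
    have h2 : inner ℝ (y k) (w k - w (k + 1))
        ≤ η / 2 * ‖y k‖ ^ 2 + ‖w k - w (k + 1)‖ ^ 2 / (2 * η) := by
      have h3 := real_inner_le_norm (y k) (w k - w (k + 1))
      have h4 : η / 2 * ‖y k‖ ^ 2 + ‖w k - w (k + 1)‖ ^ 2 / (2 * η)
          - ‖y k‖ * ‖w k - w (k + 1)‖ = (η * ‖y k‖ - ‖w k - w (k + 1)‖) ^ 2 / (2 * η) := by
        field_simp
        ring
      have h5 : 0 ≤ (η * ‖y k‖ - ‖w k - w (k + 1)‖) ^ 2 / (2 * η) := by positivity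
      linarith
    have e1 : inner ℝ (q k + y k) (w (k + 1) - u) = inner ℝ (q k) (w (k + 1) - u)
        + inner ℝ (w k - u) (y k) - inner ℝ (y k) (w k - w (k + 1)) := by
      rw [real_inner_comm (y k) (w k - u), inner_add_left, add_sub_assoc, ← inner_sub_right]
      congr 2
      abel
    rw [e1, sub_div _ (‖w k - w (k + 1)‖ ^ 2)] at h1
    linarith
  refine (Finset.sum_le_sum fun k _ => hpt k).trans ?_
  rw [Finset.sum_sub_distrib, Finset.sum_add_distrib, ← Finset.sum_div, ← Finset.mul_sum,
    Finset.sum_range_sub' fun k => ‖w k - u‖ ^ 2]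
  have h1 : ‖w 0 - u‖ ^ 2 ≤ D ^ 2 := pow_le_pow_left₀ (norm_nonneg _) (hdiam _ (hw 0) _ hu) 2
  have h2 : (‖w 0 - u‖ ^ 2 - ‖w n - u‖ ^ 2) / (2 * η) ≤ D ^ 2 / (2 * η) := by
    gcongr
    nlinarith [sq_nonneg ‖w n - u‖]
  linarith

/-- Error bound for the averaged iterate of noisy projected gradient descent with weights `k + 1`,
in terms of the errors `q k - (k + 1) ∇F (x k)` of the gradient estimates. -/
theorem weighted_gap_le {K : Set E} {D B η : ℝ} (hη : 0 < η) (hB : 0 ≤ B)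
    (hdiam : ∀ x ∈ K, ∀ y ∈ K, ‖x - y‖ ≤ D) {F : E → ℝ} {dF : E → E}
    (hF : ∀ u ∈ K, ∀ v ∈ K, F u + inner ℝ (dF u) (v - u) ≤ F v) {x w q y : ℕ → E}
    (hx : ∀ k, x k ∈ K) (hw : ∀ k, w k ∈ K) (h0 : x 0 = w 0)
    (hxstep : ∀ k : ℕ, x (k + 1) = (((k : ℝ) + 1) / (k + 3)) • x k
      + (2 / ((k : ℝ) + 3)) • w (k + 1))
    (hincr : ∀ k : ℕ, ‖((k : ℝ) + 1) • dF (x k) - (k : ℝ) • dF (x (k - 1))‖ ≤ B)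
    (hwstep : ∀ k, ∀ u ∈ K, inner ℝ ((w k - η • (q k + y k)) - w (k + 1)) (u - w (k + 1)) ≤ 0)
    {u : E} (hu : u ∈ K) (m : ℕ) :
    ((m : ℝ) + 1) * (m + 2) / 2 * (F (x m) - F u)
      ≤ ((m : ℝ) + 1) * (B * D) + D ^ 2 / (2 * η)
        + η / 2 * ∑ k ∈ Finset.range (m + 1), ‖y k‖ ^ 2
        + D * ∑ k ∈ Finset.range (m + 1), ‖q k - ((k : ℝ) + 1) • dF (x k)‖
        - ∑ k ∈ Finset.range (m + 1), inner ℝ (w k - u) (y k) := by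
  have h1 := anytime_online_to_batch hF hx h0 hxstep hu m
  have h2 := noisy_regret_le hη hdiam hw hwstep hu (m + 1)
  -- The index is shifted so that `p 0 = 0` and `p (k + 1)` is the weighted gradient at `x k`.
  have h3 := sum_inner_increments_le (p := fun k => (k : ℝ) • dF (x (k - 1))) hdiam hB hw (by simp)
    (fun k => by simpa using hincr k) (m + 1)
  have hpt : ∀ k : ℕ, ((k : ℝ) + 1) * inner ℝ (dF (x k)) (w k - u)
      ≤ ((k : ℝ) + 1) * inner ℝ (dF (x k)) (w k - w (k + 1))
        + inner ℝ (q k) (w (k + 1) - u) + D * ‖q k - ((k : ℝ) + 1) • dF (x k)‖ := by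
    intro k
    have h4 : -inner ℝ (q k - ((k : ℝ) + 1) • dF (x k)) (w (k + 1) - u)
        ≤ D * ‖q k - ((k : ℝ) + 1) • dF (x k)‖ := by
      rw [← inner_neg_right, neg_sub, mul_comm]
      exact (real_inner_le_norm _ _).trans
        (mul_le_mul_of_nonneg_left (hdiam _ hu _ (hw _)) (norm_nonneg _))
    have e : w k - u = (w k - w (k + 1)) + (w (k + 1) - u) := by abel
    rw [inner_sub_left] at h4
    simp only [inner_smul_left, RCLike.conj_to_real] at h4
    rw [e, inner_add_right, mul_add]
    linarith
  have h5 := Finset.sum_le_sum fun k (_ : k ∈ Finset.range (m + 1)) => hpt k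
  rw [Finset.sum_add_distrib, Finset.sum_add_distrib, ← Finset.mul_sum] at h5
  simp only [inner_smul_left, RCLike.conj_to_real, Nat.add_sub_cancel] at h3
  push_cast at h3
  linarith

end Regret

/-! ### Convergence -/

/-- Standing assumptions on the stochastic gradients. -/
structure StochasticGradientModel {d M : ℕ} {Z : Fin M → Type*} [∀ i, MeasurableSpace (Z i)]
    (K : Set (Vec d)) (g : ∀ i, Vec d → Z i → Vec d) (𝒟 : ∀ i, Measure (Z i))
    (D G L σ σL : ℝ) : Prop where
  compact : IsCompact K
  convex : Convex ℝ K
  diam_pos : 0 < D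
  bound_nonneg : 0 ≤ G
  lip_nonneg : 0 ≤ L
  dev_nonneg : 0 ≤ σ
  lipDev_nonneg : 0 ≤ σL
  diam : ∀ x ∈ K, ∀ y ∈ K, ‖x - y‖ ≤ D
  norm_le : ∀ i z, ∀ x ∈ K, ‖g i x z‖ ≤ G
  lipschitz : ∀ i z, ∀ x ∈ K, ∀ y ∈ K, ‖g i x z - g i y z‖ ≤ L * ‖x - y‖
  measurable : ∀ i, ∀ x ∈ K, Measurable (fun z => g i x z)
  variance_le : ∀ i, ∀ x ∈ K, ∫ z, ‖g i x z - machineGrad g 𝒟 i x‖ ^ 2 ∂(𝒟 i) ≤ σ ^ 2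
  lipVariance_le : ∀ i, ∀ x ∈ K, ∀ y ∈ K,
    ∫ z, ‖(g i x z - machineGrad g 𝒟 i x) - (g i y z - machineGrad g 𝒟 i y)‖ ^ 2 ∂(𝒟 i)
      ≤ σL ^ 2 * ‖x - y‖ ^ 2

/-- The deviation of the increment of machine `i` from its mean. -/
noncomputable def incrDev {d M : ℕ} {Z : Fin M → Type*} [∀ i, MeasurableSpace (Z i)]
    (g : ∀ i, Vec d → Z i → Vec d) (𝒟 : ∀ i, Measure (Z i)) (i : Fin M) (k : ℕ) (x x' : Vec d)
    (z : Z i) : Vec d :=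
  (((k : ℝ) + 1) • g i x z - (k : ℝ) • g i x' z)
    - (((k : ℝ) + 1) • machineGrad g 𝒟 i x - (k : ℝ) • machineGrad g 𝒟 i x')

section Model

set_option linter.unusedSectionVars false

variable {d M n : ℕ} {Z : Fin M → Type*} [∀ i, MeasurableSpace (Z i)] {K : Set (Vec d)}
  {g : ∀ i, Vec d → Z i → Vec d} {𝒟 : ∀ i, Measure (Z i)} [∀ i, IsProbabilityMeasure (𝒟 i)]
  {D G L σ σL : ℝ} {x₁ : Vec d} {η : ℝ}

namespace StochasticGradientModel

theorem integrable (h : StochasticGradientModel K g 𝒟 D G L σ σL) (i : Fin M) {x : Vec d}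
    (hx : x ∈ K) : Integrable (fun z => g i x z) (𝒟 i) :=
  Integrable.of_bound (h.measurable i x hx).aestronglyMeasurable G
    (Filter.Eventually.of_forall fun z => h.norm_le i z x hx)

theorem norm_machineGrad_le (h : StochasticGradientModel K g 𝒟 D G L σ σL) (i : Fin M)
    {x : Vec d} (hx : x ∈ K) : ‖machineGrad g 𝒟 i x‖ ≤ G := by
  have := norm_integral_le_of_norm_le_const (μ := 𝒟 i)
    (Filter.Eventually.of_forall fun z => h.norm_le i z x hx)
  simpa [machineGrad] using this

theorem norm_machineGrad_sub_le (h : StochasticGradientModel K g 𝒟 D G L σ σL) (i : Fin M)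
    {x y : Vec d} (hx : x ∈ K) (hy : y ∈ K) :
    ‖machineGrad g 𝒟 i x - machineGrad g 𝒟 i y‖ ≤ L * ‖x - y‖ := by
  rw [machineGrad, machineGrad, ← integral_sub (h.integrable i hx) (h.integrable i hy)]
  have := norm_integral_le_of_norm_le_const (μ := 𝒟 i)
    (Filter.Eventually.of_forall fun z => h.lipschitz i z x hx y hy)
  simpa using this

theorem norm_popGrad_sub_le (h : StochasticGradientModel K g 𝒟 D G L σ σL) (hM : 0 < M)
    {x y : Vec d} (hx : x ∈ K) (hy : y ∈ K) :
    ‖popGrad g 𝒟 x - popGrad g 𝒟 y‖ ≤ L * ‖x - y‖ := by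
  have hM' : (0 : ℝ) < M := by exact_mod_cast hM
  rw [popGrad, popGrad, ← smul_sub, ← Finset.sum_sub_distrib, norm_smul,
    Real.norm_of_nonneg (by positivity), one_div, inv_mul_le_iff₀ hM']
  refine (norm_sum_le _ _).trans ((Finset.sum_le_card_nsmul _ _ _ fun i _ =>
    h.norm_machineGrad_sub_le i hx hy).trans (le_of_eq ?_))
  simp

theorem norm_popGrad_le (h : StochasticGradientModel K g 𝒟 D G L σ σL) (hM : 0 < M)
    {x : Vec d} (hx : x ∈ K) : ‖popGrad g 𝒟 x‖ ≤ G := by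
  have hM' : (0 : ℝ) < M := by exact_mod_cast hM
  rw [popGrad, norm_smul, Real.norm_of_nonneg (by positivity), one_div, inv_mul_le_iff₀ hM']
  refine (norm_sum_le _ _).trans ((Finset.sum_le_card_nsmul _ _ _ fun i _ =>
    h.norm_machineGrad_le i hx).trans (le_of_eq ?_))
  simp

theorem measurable_comp (h : StochasticGradientModel K g 𝒟 D G L σ σL) (i : Fin M) {Ω : Type*}
    [MeasurableSpace Ω] {x : Ω → Vec d} (hx : Measurable x) (hxK : ∀ ω, x ω ∈ K) {ζ : Ω → Z i}
    (hζ : Measurable ζ) : Measurable fun ω => g i (x ω) (ζ ω) := by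
  have hu : Measurable (Function.uncurry fun (x : K) (z : Z i) => g i x z) :=
    measurable_uncurry_of_continuous_of_measurable
      (fun z => continuousOn_iff_continuous_domRestrict.1
        (continuousOn_of_norm_sub_le h.lip_nonneg (h.lipschitz i z)))
      fun x => h.measurable i x x.2
  exact hu.comp ((hx.subtype_mk (h := hxK)).prodMk hζ)

theorem measurable_machineGrad_comp (h : StochasticGradientModel K g 𝒟 D G L σ σL) (i : Fin M)
    {Ω : Type*} [MeasurableSpace Ω] {x : Ω → Vec d} (hx : Measurable x) (hxK : ∀ ω, x ω ∈ K) :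
    Measurable fun ω => machineGrad g 𝒟 i (x ω) :=
  measurable_comp_of_continuousOn (continuousOn_of_norm_sub_le h.lip_nonneg
    fun _ hx _ hy => h.norm_machineGrad_sub_le i hx hy) hx hxK

theorem measurable_incrDev_comp (h : StochasticGradientModel K g 𝒟 D G L σ σL) (i : Fin M) (k : ℕ)
    {Ω : Type*} [MeasurableSpace Ω] {x x' : Ω → Vec d} (hx : Measurable x) (hxK : ∀ ω, x ω ∈ K)
    (hx' : Measurable x') (hxK' : ∀ ω, x' ω ∈ K) {ζ : Ω → Z i} (hζ : Measurable ζ) :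
    Measurable fun ω => incrDev g 𝒟 i k (x ω) (x' ω) (ζ ω) := by
  have h1 := h.measurable_comp i hx hxK hζ
  have h2 := h.measurable_comp i hx' hxK' hζ
  have h3 := h.measurable_machineGrad_comp i hx hxK
  have h4 := h.measurable_machineGrad_comp i hx' hxK'
  exact ((h1.const_smul ((k : ℝ) + 1)).sub (h2.const_smul (k : ℝ))).sub
    ((h3.const_smul ((k : ℝ) + 1)).sub (h4.const_smul (k : ℝ)))

theorem integral_incrDev (h : StochasticGradientModel K g 𝒟 D G L σ σL) (i : Fin M) (k : ℕ)
    {x x' : Vec d} (hx : x ∈ K) (hx' : x' ∈ K) :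
    ∫ z, incrDev g 𝒟 i k x x' z ∂(𝒟 i) = 0 := by
  have h1 : Integrable (fun z => ((k : ℝ) + 1) • g i x z) (𝒟 i) := (h.integrable i hx).smul ((k : ℝ) + 1)
  have h2 : Integrable (fun z => (k : ℝ) • g i x' z) (𝒟 i) := (h.integrable i hx').smul (k : ℝ)
  have h12 : Integrable (fun z => ((k : ℝ) + 1) • g i x z - (k : ℝ) • g i x' z) (𝒟 i) := h1.sub h2
  simp only [incrDev]
  rw [integral_sub h12 (integrable_const _), integral_sub h1 h2, integral_smul, integral_smul,
    integral_const]
  simp [machineGrad]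

theorem norm_incrDev_le (h : StochasticGradientModel K g 𝒟 D G L σ σL) (i : Fin M) (k : ℕ)
    {x x' : Vec d} (hx : x ∈ K) (hx' : x' ∈ K) (z : Z i) :
    ‖incrDev g 𝒟 i k x x' z‖ ≤ 2 * (2 * k + 1) * G := by
  have hk : ∀ u v : Vec d, ‖u‖ ≤ G → ‖v‖ ≤ G →
      ‖((k : ℝ) + 1) • u - (k : ℝ) • v‖ ≤ (2 * k + 1) * G := by
    intro u v hu hv
    refine (norm_sub_le _ _).trans ?_
    rw [norm_smul, norm_smul, Real.norm_of_nonneg (by positivity),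
      Real.norm_of_nonneg (by positivity)]
    have h1 := mul_le_mul_of_nonneg_left hu (by positivity : (0 : ℝ) ≤ (k : ℝ) + 1)
    have h2 := mul_le_mul_of_nonneg_left hv (by positivity : (0 : ℝ) ≤ (k : ℝ))
    linarith
  refine (norm_sub_le _ _).trans ?_
  have h1 := hk _ _ (h.norm_le i z x hx) (h.norm_le i z x' hx')
  have h2 := hk _ _ (h.norm_machineGrad_le i hx) (h.norm_machineGrad_le i hx')
  linarith

/-- The deviation is `u + k (u - u')` with `u`, `u'` the gradient noises at `x`, `x'`. The first
part has `L²` norm at most `σ`, the second at most `σ_L k ‖x - x'‖ ≤ 2 σ_L D`. -/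
theorem integral_norm_incrDev_sq_le (h : StochasticGradientModel K g 𝒟 D G L σ σL) (i : Fin M)
    (k : ℕ) {x x' : Vec d} (hx : x ∈ K) (hx' : x' ∈ K) (hxx' : (k : ℝ) * ‖x - x'‖ ≤ 2 * D) :
    ∫ z, ‖incrDev g 𝒟 i k x x' z‖ ^ 2 ∂(𝒟 i) ≤ (σ + 2 * σL * D) ^ 2 := by
  set u : Z i → Vec d := fun z => g i x z - machineGrad g 𝒟 i x
  set u' : Z i → Vec d := fun z => g i x' z - machineGrad g 𝒟 i x'
  have e : ∀ z, incrDev g 𝒟 i k x x' z = u z + (k : ℝ) • (u z - u' z) := by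
    intro z
    simp only [incrDev, u, u']
    module
  have hum : ∀ {y}, y ∈ K → MemLp (fun z => g i y z - machineGrad g 𝒟 i y) 2 (𝒟 i) := by
    intro y hy
    refine MemLp.of_bound ((h.measurable i y hy).sub_const _).aestronglyMeasurable (G + G)
      (Filter.Eventually.of_forall fun z => (norm_sub_le _ _).trans
        (add_le_add (h.norm_le i z y hy) (h.norm_machineGrad_le i hy)))
  have hu : MemLp u 2 (𝒟 i) := hum hx
  have hv : MemLp (fun z => (k : ℝ) • (u z - u' z)) 2 (𝒟 i) := (hu.sub (hum hx')).const_smul (k : ℝ)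
  have hk : ∫ z, ‖(k : ℝ) • (u z - u' z)‖ ^ 2 ∂(𝒟 i) ≤ (2 * σL * D) ^ 2 := by
    simp_rw [norm_smul, mul_pow]
    rw [integral_const_mul]
    have h1 := h.lipVariance_le i x hx x' hx'
    have h2 := mul_le_mul_of_nonneg_left h1 (sq_nonneg ‖(k : ℝ)‖)
    refine h2.trans ?_
    rw [Real.norm_of_nonneg (by positivity)]
    calc (k : ℝ) ^ 2 * (σL ^ 2 * ‖x - x'‖ ^ 2) = σL ^ 2 * (k * ‖x - x'‖) ^ 2 := by ring
      _ ≤ σL ^ 2 * (2 * D) ^ 2 := by gcongr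
      _ = _ := by ring
  simp_rw [e]
  refine integral_norm_add_sq_le h.dev_nonneg ?_ hu.norm.integrable_sq hv.norm.integrable_sq
    (h.variance_le i x hx) (hk.trans (le_of_eq (by ring)))
  have := h.lipDev_nonneg
  have := h.diam_pos
  positivity

end StochasticGradientModel

/-- The means of the increments telescope to `(k + 1) ∇f_i(x_k)`. Truncated subtraction at `0` is
harmless, being multiplied by `0`. -/
theorem aggEst_sub_popGrad {s : ℕ → FLState d M} {z : ℕ → ∀ i, Z i}
    (hs : ∀ k, (s k).xPrev = (s (k - 1)).x) (k : ℕ) :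
    aggEst g z s k - ((k : ℝ) + 1) • popGrad g 𝒟 (s k).x
      = (1 / (M : ℝ)) • ∑ i, ∑ j ∈ Finset.range (k + 1),
        incrDev g 𝒟 i j (s j).x (s j).xPrev (z j i) := by
  have htel : ∀ i, ∑ j ∈ Finset.range (k + 1), (((j : ℝ) + 1) • machineGrad g 𝒟 i (s j).x
      - (j : ℝ) • machineGrad g 𝒟 i (s j).xPrev) = ((k : ℝ) + 1) • machineGrad g 𝒟 i (s k).x := by
    intro i
    simp_rw [hs]
    have := Finset.sum_range_sub (fun j : ℕ => (j : ℝ) • machineGrad g 𝒟 i (s (j - 1)).x) (k + 1)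
    simpa using this
  have e : ∀ i, ∑ j ∈ Finset.range (k + 1), incrDev g 𝒟 i j (s j).x (s j).xPrev (z j i)
      = ∑ j ∈ Finset.range (k + 1), estIncr g z s j i
        - ((k : ℝ) + 1) • machineGrad g 𝒟 i (s k).x := by
    intro i
    rw [← htel i, ← Finset.sum_sub_distrib]
    rfl
  simp_rw [e]
  rw [Finset.sum_sub_distrib, smul_sub, ← Finset.smul_sum, aggEst, popGrad, smul_comm]

/-- Joint law of the data and of Gaussian noise of variance `v`. -/
noncomputable abbrev gaussDataLaw (n d : ℕ) (v : NNReal) (𝒟 : ∀ i, Measure (Z i)) :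
    Measure ((∀ i, Fin n → Z i) × (Fin n → Vec d)) :=
  dataNoiseLaw n 𝒟 (Measure.pi fun _ : Fin n => isoGaussian d v)

instance {v : NNReal} : IsProbabilityMeasure
    (gaussDataLaw n d v 𝒟) := by
  unfold gaussDataLaw dataNoiseLaw
  infer_instance

/-- The trajectory as a random process on the space of data and noise. -/
noncomputable def randTraj (hn : 0 < n) (K : Set (Vec d)) (g : ∀ i, Vec d → Z i → Vec d)
    (x₁ : Vec d) (η : ℝ) (ω : (∀ i, Fin n → Z i) × (Fin n → Vec d)) : ℕ → FLState d M :=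
  traj K g x₁ η (dataStream hn ω.1) (noiseStream hn ω.2)

/-- Replace the `j`-th sample of machine `i`. -/
def resampleData (i : Fin M) (j : Fin n)
    (p : ((∀ i, Fin n → Z i) × (Fin n → Vec d)) × Z i) :
    (∀ i, Fin n → Z i) × (Fin n → Vec d) :=
  (Function.update p.1.1 i (Function.update (p.1.1 i) j p.2), p.1.2)

/-- Replace the `j`-th noise vector. -/
def resampleNoise (j : Fin n) (p : ((∀ i, Fin n → Z i) × (Fin n → Vec d)) × Vec d) :
    (∀ i, Fin n → Z i) × (Fin n → Vec d) :=
  (p.1.1, Function.update p.1.2 j p.2)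

theorem measurePreserving_resampleData {μ : Measure (Fin n → Vec d)} [SFinite μ] (i : Fin M)
    (j : Fin n) : MeasurePreserving (resampleData (d := d) (Z := Z) i j)
      ((dataNoiseLaw n 𝒟 μ).prod (𝒟 i)) (dataNoiseLaw n 𝒟 μ) := by
  have h1 := measurePreserving_update (fun _ : Fin n => 𝒟 i) j
  have h2 : MeasurePreserving (fun p : (∀ i, Fin n → Z i) × Z i =>
      Function.update p.1 i (Function.update (p.1 i) j p.2)) _ _ :=
    h1.update_comp (μ := fun i => Measure.pi fun _ : Fin n => 𝒟 i) (i := i)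
  exact h2.resample_fst

theorem measurePreserving_resampleNoise {γ : Measure (Vec d)} [IsProbabilityMeasure γ]
    (j : Fin n) : MeasurePreserving (resampleNoise (d := d) (Z := Z) j)
      ((dataNoiseLaw n 𝒟 (Measure.pi fun _ => γ)).prod γ)
      (dataNoiseLaw n 𝒟 (Measure.pi fun _ => γ)) :=
  (measurePreserving_update (fun _ : Fin n => γ) j).resample_snd

theorem dataStream_resampleData_of_ne (hn : 0 < n) {i i' : Fin M} {j : Fin n} {j' : ℕ}
    (hj' : j' < n) (hne : i' ≠ i ∨ j' ≠ j) (p) :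
    dataStream hn (resampleData (d := d) (Z := Z) i j p).1 j' i' = dataStream hn p.1.1 j' i' := by
  simp only [dataStream, resampleData, clipIdx_of_lt hn hj']
  by_cases hi : i' = i
  · subst hi
    have hj : (⟨j', hj'⟩ : Fin n) ≠ j := fun h => (hne.resolve_left fun h' => h' rfl)
      (congrArg Fin.val h)
    rw [Function.update_self, Function.update_of_ne hj]
  · rw [Function.update_of_ne hi]

theorem dataStream_resampleData_self (hn : 0 < n) (i : Fin M) (j : Fin n) (p) :
    dataStream hn (resampleData (d := d) (Z := Z) i j p).1 j i = p.2 := by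
  simp [dataStream, resampleData, clipIdx_of_lt hn j.isLt]

/-- State `j` has used only samples with index below `j`, so it is independent of sample `j`. -/
theorem randTraj_resampleData (hn : 0 < n) (i : Fin M) (j : Fin n) (p) {k : ℕ} (hk : k ≤ j) :
    randTraj hn K g x₁ η (resampleData i j p) k = randTraj hn K g x₁ η p.1 k :=
  traj_congr k (fun m hm => funext fun i' =>
    dataStream_resampleData_of_ne hn (by omega) (Or.inr (by omega)) p) fun _ _ => rfl

theorem randTraj_resampleNoise (hn : 0 < n) (j : Fin n)
    (p : ((∀ i, Fin n → Z i) × (Fin n → Vec d)) × Vec d) {k : ℕ} (hk : k ≤ j) :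
    randTraj hn K g x₁ η (resampleNoise j p) k = randTraj hn K g x₁ η p.1 k := by
  refine traj_congr k (fun m hm => rfl) fun m hm => ?_
  have hmn : m < n := by omega
  simp only [noiseStream, resampleNoise, clipIdx_of_lt hn hmn]
  exact Function.update_of_ne (fun h => by
    have := congrArg Fin.val h
    simp only at this
    omega) _ _

theorem measurable_dataStream (hn : 0 < n) (k : ℕ) (i : Fin M) :
    Measurable fun ω : (∀ i, Fin n → Z i) × (Fin n → Vec d) => dataStream hn ω.1 k i :=
  (measurable_pi_apply _).comp ((measurable_pi_apply i).comp measurable_fst)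

theorem measurable_noiseStream (hn : 0 < n) (k : ℕ) :
    Measurable fun ω : (∀ i, Fin n → Z i) × (Fin n → Vec d) => noiseStream hn ω.2 k :=
  (measurable_pi_apply _).comp measurable_snd

theorem measurable_randTraj (h : StochasticGradientModel K g 𝒟 D G L σ σL) (hx₁ : x₁ ∈ K)
    (hn : 0 < n) (k : ℕ) :
    (Measurable fun ω => (randTraj hn K g x₁ η ω k).w) ∧
      (Measurable fun ω => (randTraj hn K g x₁ η ω k).x) :=
  measurable_traj h.compact h.convex hx₁ (measurable_noiseStream hn)
    (fun i k _ hx hxK => h.measurable_comp i hx hxK (measurable_dataStream hn k i)) k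

/-- The deviation of the `j`-th increment of machine `i` along the trajectory. -/
noncomputable def randDev (hn : 0 < n) (K : Set (Vec d)) (g : ∀ i, Vec d → Z i → Vec d)
    (𝒟 : ∀ i, Measure (Z i)) (x₁ : Vec d) (η : ℝ) (p : Fin M × ℕ)
    (ω : (∀ i, Fin n → Z i) × (Fin n → Vec d)) : Vec d :=
  incrDev g 𝒟 p.1 p.2 (randTraj hn K g x₁ η ω p.2).x (randTraj hn K g x₁ η ω p.2).xPrev
    (dataStream hn ω.1 p.2 p.1)

theorem randTraj_mem (h : StochasticGradientModel K g 𝒟 D G L σ σL) (hx₁ : x₁ ∈ K)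
    (hn : 0 < n) (ω) (k : ℕ) :
    (randTraj hn K g x₁ η ω k).w ∈ K ∧ (randTraj hn K g x₁ η ω k).x ∈ K :=
  traj_mem h.compact h.convex hx₁ k

theorem randTraj_xPrev_mem (h : StochasticGradientModel K g 𝒟 D G L σ σL) (hx₁ : x₁ ∈ K)
    (hn : 0 < n) (ω) (k : ℕ) : (randTraj hn K g x₁ η ω k).xPrev ∈ K :=
  traj_xPrev_mem h.compact h.convex hx₁ k

theorem measurable_randDev (h : StochasticGradientModel K g 𝒟 D G L σ σL) (hx₁ : x₁ ∈ K)
    (hn : 0 < n) (p : Fin M × ℕ) : Measurable (randDev hn K g 𝒟 x₁ η p) := by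
  refine h.measurable_incrDev_comp p.1 p.2 (measurable_randTraj h hx₁ hn p.2).2
    (fun ω => (randTraj_mem h hx₁ hn ω p.2).2) ?_ (fun ω => randTraj_xPrev_mem h hx₁ hn ω p.2)
    (measurable_dataStream hn p.2 p.1)
  simp only [randTraj, traj_xPrev]
  exact (measurable_randTraj h hx₁ hn _).2

theorem norm_randDev_le (h : StochasticGradientModel K g 𝒟 D G L σ σL) (hx₁ : x₁ ∈ K)
    (hn : 0 < n) (p : Fin M × ℕ) (ω) :
    ‖randDev hn K g 𝒟 x₁ η p ω‖ ≤ 2 * (2 * p.2 + 1) * G :=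
  h.norm_incrDev_le p.1 p.2 (randTraj_mem h hx₁ hn ω p.2).2 (randTraj_xPrev_mem h hx₁ hn ω p.2) _

variable {v : NNReal}

theorem integrable_inner_randDev (h : StochasticGradientModel K g 𝒟 D G L σ σL) (hx₁ : x₁ ∈ K)
    (hn : 0 < n) (p q : Fin M × ℕ) :
    Integrable (fun ω => inner ℝ (randDev hn K g 𝒟 x₁ η p ω) (randDev hn K g 𝒟 x₁ η q ω)) (gaussDataLaw n d v 𝒟) := by
  refine Integrable.of_bound ((measurable_randDev h hx₁ hn p).inner
    (measurable_randDev h hx₁ hn q)).aestronglyMeasurable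
    ((2 * (2 * p.2 + 1) * G) * (2 * (2 * q.2 + 1) * G))
    (Filter.Eventually.of_forall fun ω => (norm_inner_le_norm _ _).trans ?_)
  exact mul_le_mul (norm_randDev_le h hx₁ hn p ω) (norm_randDev_le h hx₁ hn q ω) (norm_nonneg _)
    ((norm_nonneg _).trans (norm_randDev_le (η := η) h hx₁ hn p ω))

theorem randDev_resampleData_self (hn : 0 < n) (i : Fin M) (j : Fin n) (p) :
    randDev hn K g 𝒟 x₁ η (i, (j : ℕ)) (resampleData i j p)
      = incrDev g 𝒟 i j (randTraj hn K g x₁ η p.1 j).x (randTraj hn K g x₁ η p.1 j).xPrev p.2 := by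
  simp only [randDev]
  rw [randTraj_resampleData hn i j p le_rfl, dataStream_resampleData_self]

theorem integral_inner_randDev_eq_zero (h : StochasticGradientModel K g 𝒟 D G L σ σL)
    (hx₁ : x₁ ∈ K) (hn : 0 < n) {p q : Fin M × ℕ} (hp : p.2 < n) (hq : q.2 < n) (hpq : p ≠ q) :
    ∫ ω, inner ℝ (randDev hn K g 𝒟 x₁ η p ω) (randDev hn K g 𝒟 x₁ η q ω) ∂(gaussDataLaw n d v 𝒟) = 0 := by
  -- Resample the datum read by the later deviation. The other one is unaffected, even in the same
  -- round, since it then reads a different machine's sample.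
  wlog hle : p.2 ≤ q.2 generalizing p q
  · simp_rw [real_inner_comm (randDev hn K g 𝒟 x₁ η q _)]
    exact this hq hp hpq.symm (by omega)
  obtain ⟨i', j'⟩ := p
  obtain ⟨i, j⟩ := q
  simp only at hp hq hle
  refine integral_inner_eq_zero_of_resample (measurePreserving_resampleData i ⟨j, hq⟩)
    (integrable_inner_randDev h hx₁ hn _ _) (fun ω a => ?_) (fun ω => ?_) fun ω => ?_
  · simp only [randDev]
    rw [randTraj_resampleData hn i ⟨j, hq⟩ (ω, a) hle, dataStream_resampleData_of_ne hn hp]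
    by_contra! hcon
    exact hpq (Prod.ext hcon.1 hcon.2)
  · have hm := ((measurable_randDev h hx₁ hn (i, j) (η := η)).comp
      (measurePreserving_resampleData (𝒟 := 𝒟) (μ := Measure.pi fun _ : Fin n => isoGaussian d v)
        i ⟨j, hq⟩).measurable).comp (measurable_prodMk_left (x := ω))
    exact Integrable.of_bound hm.aestronglyMeasurable _
      (Filter.Eventually.of_forall fun a => norm_randDev_le h hx₁ hn (i, j) _)
  · have e := fun a => randDev_resampleData_self (K := K) (g := g) (𝒟 := 𝒟) (x₁ := x₁) (η := η) hn
      i ⟨j, hq⟩ (ω, a)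
    simp only at e
    simp_rw [e]
    exact h.integral_incrDev i j (randTraj_mem h hx₁ hn ω j).2 (randTraj_xPrev_mem h hx₁ hn ω j)

/-- Given everything but the sample it reads, the query points are frozen, and the bound for fixed
points applies. -/
theorem integral_norm_randDev_sq_le (h : StochasticGradientModel K g 𝒟 D G L σ σL)
    (hx₁ : x₁ ∈ K) (hn : 0 < n) {p : Fin M × ℕ} (hp : p.2 < n) :
    ∫ ω, ‖randDev hn K g 𝒟 x₁ η p ω‖ ^ 2 ∂(gaussDataLaw n d v 𝒟) ≤ (σ + 2 * σL * D) ^ 2 := by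
  obtain ⟨i, j⟩ := p
  simp only at hp
  refine integral_le_of_resample (measurePreserving_resampleData i ⟨j, hp⟩) ?_ fun ω => ?_
  · simpa only [real_inner_self_eq_norm_sq] using
      integrable_inner_randDev (η := η) (v := v) h hx₁ hn (i, j) (i, j)
  · have e := fun a => randDev_resampleData_self (K := K) (g := g) (𝒟 := 𝒟) (x₁ := x₁) (η := η) hn
      i ⟨j, hp⟩ (ω, a)
    simp only at e
    simp_rw [e]
    exact h.integral_norm_incrDev_sq_le i j (randTraj_mem h hx₁ hn ω j).2
      (randTraj_xPrev_mem h hx₁ hn ω j) (traj_step_le h.compact h.convex hx₁ h.diam j)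

/-- The error of the aggregated weighted estimate. -/
noncomputable def estError (hn : 0 < n) (K : Set (Vec d)) (g : ∀ i, Vec d → Z i → Vec d)
    (𝒟 : ∀ i, Measure (Z i)) (x₁ : Vec d) (η : ℝ) (k : ℕ)
    (ω : (∀ i, Fin n → Z i) × (Fin n → Vec d)) : Vec d :=
  aggEst g (dataStream hn ω.1) (randTraj hn K g x₁ η ω) k
    - ((k : ℝ) + 1) • popGrad g 𝒟 (randTraj hn K g x₁ η ω k).x

theorem estError_eq_sum (hn : 0 < n) (k : ℕ) (ω) :
    estError hn K g 𝒟 x₁ η k ω = (1 / (M : ℝ)) •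
      ∑ p ∈ Finset.univ ×ˢ Finset.range (k + 1), randDev hn K g 𝒟 x₁ η p ω := by
  rw [estError, aggEst_sub_popGrad (fun k => traj_xPrev k), Finset.sum_product]
  rfl

theorem memLp_estError (h : StochasticGradientModel K g 𝒟 D G L σ σL) (hx₁ : x₁ ∈ K)
    (hn : 0 < n) (k : ℕ) : MemLp (estError hn K g 𝒟 x₁ η k) 2 (gaussDataLaw n d v 𝒟) := by
  have e : estError hn K g 𝒟 x₁ η k = fun ω => (1 / (M : ℝ)) •
      ∑ p ∈ Finset.univ ×ˢ Finset.range (k + 1), randDev hn K g 𝒟 x₁ η p ω :=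
    funext (estError_eq_sum hn k)
  rw [e]
  have hs : MemLp (fun ω => ∑ p ∈ Finset.univ ×ˢ Finset.range (k + 1),
      randDev hn K g 𝒟 x₁ η p ω) 2 (gaussDataLaw n d v 𝒟) := memLp_finsetSum _ fun p _ =>
    MemLp.of_bound (measurable_randDev h hx₁ hn p).aestronglyMeasurable _
      (Filter.Eventually.of_forall fun ω => norm_randDev_le h hx₁ hn p ω)
  exact hs.const_smul (1 / (M : ℝ))

theorem integral_norm_estError_le (h : StochasticGradientModel K g 𝒟 D G L σ σL) (hx₁ : x₁ ∈ K)
    (hM : 0 < M) (hn : 0 < n) {k : ℕ} (hk : k < n) :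
    ∫ ω, ‖estError hn K g 𝒟 x₁ η k ω‖ ∂(gaussDataLaw n d v 𝒟) ≤ √n * (σ + 2 * σL * D) / √M := by
  have hM' : (0 : ℝ) < M := by exact_mod_cast hM
  have hσ : 0 ≤ σ + 2 * σL * D := by
    have := h.dev_nonneg
    have := h.lipDev_nonneg
    have := h.diam_pos
    positivity
  have hL2 : MemLp (estError hn K g 𝒟 x₁ η k) 2 (gaussDataLaw n d v 𝒟) :=
    memLp_estError h hx₁ hn k
  refine integral_norm_le_of_sq (by positivity) hL2.norm.integrable_sq
    (hL2.integrable (by norm_num)).norm ?_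
  simp_rw [estError_eq_sum, norm_smul, mul_pow]
  rw [integral_const_mul]
  have hlt : ∀ p ∈ (Finset.univ : Finset (Fin M)) ×ˢ Finset.range (k + 1), p.2 < n := by
    intro p hp
    have := Finset.mem_range.1 (Finset.mem_product.1 hp).2
    omega
  have hsum := integral_norm_sum_sq_le (P := (gaussDataLaw n d v 𝒟)) (Finset.univ ×ˢ Finset.range (k + 1))
    (V := randDev hn K g 𝒟 x₁ η) (c := (σ + 2 * σL * D) ^ 2)
    (fun p _ q _ => integrable_inner_randDev h hx₁ hn p q)
    (fun p hp q hq hpq => integral_inner_randDev_eq_zero h hx₁ hn (hlt p hp) (hlt q hq) hpq)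
    (fun p hp => integral_norm_randDev_sq_le h hx₁ hn (hlt p hp))
  rw [Finset.card_product, Finset.card_univ, Fintype.card_fin, Finset.card_range] at hsum
  rw [Real.norm_of_nonneg (by positivity), div_pow (√n * _), mul_pow (√n), Real.sq_sqrt (by positivity),
    Real.sq_sqrt (by positivity)]
  have hkn : ((k + 1 : ℕ) : ℝ) ≤ n := by exact_mod_cast hk
  -- There are `M (k + 1)` orthogonal terms and a factor `1/M²`, which leaves `(k + 1)/M ≤ n/M`.
  calc (1 / (M : ℝ)) ^ 2 * _ ≤ (1 / (M : ℝ)) ^ 2 * (((M * (k + 1) : ℕ) : ℝ)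
        * (σ + 2 * σL * D) ^ 2) := by gcongr
    _ = ((k + 1 : ℕ) : ℝ) * (σ + 2 * σL * D) ^ 2 / M := by
      rw [Nat.cast_mul]
      field_simp
    _ ≤ _ := by gcongr

theorem measurePreserving_noiseStream (hn : 0 < n) (k : ℕ) :
    MeasurePreserving (fun ω : (∀ i, Fin n → Z i) × (Fin n → Vec d) => noiseStream hn ω.2 k) (gaussDataLaw n d v 𝒟)
      (isoGaussian d v) :=
  (measurePreserving_eval (fun _ : Fin n => isoGaussian d v) (clipIdx hn k)).comp
    measurePreserving_snd

theorem memLp_noiseStream (hn : 0 < n) (k : ℕ) :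
    MemLp (fun ω : (∀ i, Fin n → Z i) × (Fin n → Vec d) => noiseStream hn ω.2 k) 2 (gaussDataLaw n d v 𝒟) :=
  memLp_id_isoGaussian.comp_measurePreserving (measurePreserving_noiseStream hn k)

theorem integral_norm_noiseStream_sq (hn : 0 < n) (k : ℕ) :
    ∫ ω, ‖noiseStream hn ω.2 k‖ ^ 2 ∂(gaussDataLaw n d v 𝒟) = d * v := by
  have hmp := measurePreserving_noiseStream (𝒟 := 𝒟) (v := v) (d := d) hn k
  have h1 := integral_norm_sq_isoGaussian (d := d) (v := v)
  rw [← hmp.map_eq, integral_map hmp.measurable.aemeasurable (by fun_prop)] at h1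
  exact h1

theorem integrable_inner_noise (h : StochasticGradientModel K g 𝒟 D G L σ σL) (hx₁ : x₁ ∈ K)
    (hn : 0 < n) {u : Vec d} (hu : u ∈ K) (k : ℕ) :
    Integrable (fun ω => inner ℝ ((randTraj hn K g x₁ η ω k).w - u) (noiseStream hn ω.2 k)) (gaussDataLaw n d v 𝒟) := by
  have hn1 := ((memLp_noiseStream (𝒟 := 𝒟) (v := v) (d := d) hn k).integrable
    (by norm_num)).norm.const_mul D
  refine hn1.mono' (((measurable_randTraj h hx₁ hn k).1.sub_const u).inner
    (measurable_noiseStream hn k)).aestronglyMeasurable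
    (Filter.Eventually.of_forall fun ω => (norm_inner_le_norm _ _).trans ?_)
  exact mul_le_mul_of_nonneg_right (h.diam _ (randTraj_mem h hx₁ hn ω k).1 _ hu) (norm_nonneg _)

theorem integral_inner_noise (h : StochasticGradientModel K g 𝒟 D G L σ σL) (hx₁ : x₁ ∈ K)
    (hn : 0 < n) {u : Vec d} (hu : u ∈ K) {k : ℕ} (hk : k < n) :
    ∫ ω, inner ℝ ((randTraj hn K g x₁ η ω k).w - u) (noiseStream hn ω.2 k) ∂(gaussDataLaw n d v 𝒟) = 0 := by
  have e : ∀ (ω : (∀ i, Fin n → Z i) × (Fin n → Vec d)) a, noiseStream hn (resampleNoise ⟨k, hk⟩ (ω, a)).2 k = a := by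
    intro ω a
    simp [noiseStream, resampleNoise, clipIdx_of_lt hn hk]
  refine integral_inner_eq_zero_of_resample (measurePreserving_resampleNoise ⟨k, hk⟩)
    (integrable_inner_noise h hx₁ hn hu k) (fun ω a => ?_) (fun ω => ?_) fun ω => ?_
  · rw [randTraj_resampleNoise hn ⟨k, hk⟩ (ω, a) le_rfl]
  · simp_rw [e]
    exact memLp_id_isoGaussian.integrable (by norm_num)
  · simp_rw [e]
    exact integral_id_isoGaussian

end Model

/-! ### First-order inequalities and the expected gap -/

section Convergence

/-- Restrict to the segment from `x` to `y`, where the right derivative at `0` is at most the slope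
of the chord. Only a gradient relative to `K` is needed. -/
theorem ConvexOn.add_inner_le_of_hasGradientWithinAt {E : Type*} [NormedAddCommGroup E]
    [InnerProductSpace ℝ E] [CompleteSpace E] {K : Set E} {f : E → ℝ} (hf : ConvexOn ℝ K f)
    {x y v : E} (hx : x ∈ K) (hy : y ∈ K) (hv : HasGradientWithinAt f v K x) :
    f x + inner ℝ v (y - x) ≤ f y := by
  set A : ℝ →ᵃ[ℝ] E := AffineMap.lineMap x y
  have hmaps : Set.MapsTo A (Set.Icc 0 1) K := fun t ht => hf.1.lineMap_mem hx hy ht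
  have hconv : ConvexOn ℝ (Set.Icc (0 : ℝ) 1) (f ∘ A) :=
    (hf.comp_affineMap A).subset hmaps (convex_Icc 0 1)
  have hA : HasDerivWithinAt A (y - x) (Set.Icc (0 : ℝ) 1) 0 := AffineMap.hasDerivWithinAt_lineMap
  have hA0 : x = A 0 := (AffineMap.lineMap_apply_zero x y).symm
  have hA1 : A 1 = y := AffineMap.lineMap_apply_one x y
  have hder := (hasGradientWithinAt_iff_hasFDerivWithinAt.1 hv).comp_hasDerivWithinAt_of_eq 0 hA
    hmaps hA0
  have h := hconv.le_slope_of_hasDerivWithinAt (by simp) (by simp) zero_lt_one hder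
  rw [slope_def_field, InnerProductSpace.toDual_apply_apply] at h
  simp only [Function.comp_apply, hA1, ← hA0, sub_zero, div_one] at h
  linarith

variable {d M n : ℕ} {Z : Fin M → Type*} [∀ i, MeasurableSpace (Z i)] {K : Set (Vec d)}
  {g : ∀ i, Vec d → Z i → Vec d} {𝒟 : ∀ i, Measure (Z i)} [∀ i, IsProbabilityMeasure (𝒟 i)]
  {D G L σ σL : ℝ} {x₁ : Vec d} {η : ℝ} {v : NNReal}

/-- Integrating the inequality of each sample avoids differentiating under the integral sign. -/
theorem popLoss_add_inner_le (h : StochasticGradientModel K g 𝒟 D G L σ σL)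
    {f : ∀ i, Vec d → Z i → ℝ}
    (hgrad : ∀ i z, ∀ x ∈ K, HasGradientWithinAt (fun y => f i y z) (g i x z) K x)
    (hconv : ∀ i, ∀ᵐ z ∂(𝒟 i), ConvexOn ℝ K (fun x => f i x z))
    (hint : ∀ i, ∀ x ∈ K, Integrable (fun z => f i x z) (𝒟 i)) {u w : Vec d} (hu : u ∈ K)
    (hw : w ∈ K) :
    popLoss f 𝒟 u + inner ℝ (popGrad g 𝒟 u) (w - u) ≤ popLoss f 𝒟 w := by
  rw [popLoss, popLoss, popGrad, inner_smul_left, sum_inner, RCLike.conj_to_real, ← mul_add,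
    ← Finset.sum_add_distrib]
  refine mul_le_mul_of_nonneg_left (Finset.sum_le_sum fun i _ => ?_) (by positivity)
  have hin : Integrable (fun z => inner ℝ (w - u) (g i u z)) (𝒟 i) :=
    (h.integrable i hu).const_inner _
  rw [real_inner_comm, machineGrad, ← integral_inner (h.integrable i hu),
    ← integral_add (hint i u hu) hin]
  refine integral_mono_ae ((hint i u hu).add hin) (hint i w hw) ?_
  filter_upwards [hconv i] with z hz
  rw [real_inner_comm]
  exact hz.add_inner_le_of_hasGradientWithinAt hu hw (hgrad i z u hu)

theorem abs_sub_le_of_add_inner_le {E : Type*} [NormedAddCommGroup E] [InnerProductSpace ℝ E]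
    {K : Set E} {F : E → ℝ} {dF : E → E} {G : ℝ} (hG : ∀ x ∈ K, ‖dF x‖ ≤ G)
    (hF : ∀ u ∈ K, ∀ v ∈ K, F u + inner ℝ (dF u) (v - u) ≤ F v) :
    ∀ u ∈ K, ∀ v ∈ K, ‖F u - F v‖ ≤ G * ‖u - v‖ := by
  have key : ∀ u ∈ K, ∀ v ∈ K, F u - F v ≤ G * ‖u - v‖ := by
    intro u hu v hv
    have h1 := hF u hu v hv
    have h2 : inner ℝ (dF u) (u - v) ≤ G * ‖u - v‖ := (real_inner_le_norm _ _).trans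
      (mul_le_mul_of_nonneg_right (hG u hu) (norm_nonneg _))
    rw [← neg_sub u v, inner_neg_right] at h1
    linarith
  intro u hu v hv
  rw [Real.norm_eq_abs, abs_sub_le_iff]
  exact ⟨key u hu v hv, norm_sub_rev u v ▸ key v hv u hu⟩

theorem integrable_comp_randTraj (h : StochasticGradientModel K g 𝒟 D G L σ σL) (hx₁ : x₁ ∈ K)
    (hn : 0 < n) {F : Vec d → ℝ} (hF : ∀ u ∈ K, ∀ v ∈ K, ‖F u - F v‖ ≤ G * ‖u - v‖) (k : ℕ) :
    Integrable (fun ω => F (randTraj hn K g x₁ η ω k).x) (gaussDataLaw n d v 𝒟) := by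
  have hm := measurable_comp_of_continuousOn (continuousOn_of_norm_sub_le h.bound_nonneg hF)
    (measurable_randTraj (η := η) h hx₁ hn k).2 (fun ω => (randTraj_mem h hx₁ hn ω k).2)
  refine Integrable.of_bound hm.aestronglyMeasurable (‖F x₁‖ + G * D)
    (Filter.Eventually.of_forall fun ω => ?_)
  have hx := (randTraj_mem (η := η) h hx₁ hn ω k).2
  have h1 := (hF _ hx _ hx₁).trans (mul_le_mul_of_nonneg_left (h.diam _ hx _ hx₁) h.bound_nonneg)
  have h2 := norm_le_norm_add_norm_sub' (F (randTraj hn K g x₁ η ω k).x) (F x₁)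
  linarith

theorem expected_gap_le (h : StochasticGradientModel K g 𝒟 D G L σ σL) (hx₁ : x₁ ∈ K)
    (hM : 0 < M) (hn : 0 < n) (hη : 0 < η) {F : Vec d → ℝ}
    (hF : ∀ u ∈ K, ∀ v ∈ K, F u + inner ℝ (popGrad g 𝒟 u) (v - u) ≤ F v) {u : Vec d}
    (hu : u ∈ K) :
    (n : ℝ) * (n + 1) / 2
        * ((∫ ω, F (randTraj hn K g x₁ η ω (n - 1)).x ∂(gaussDataLaw n d v 𝒟)) - F u)
      ≤ n * ((‖popGrad g 𝒟 u‖ + 3 * L * D) * D) + D ^ 2 / (2 * η) + η / 2 * (n * (d * v))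
        + D * (n * (√n * (σ + 2 * σL * D) / √M)) := by
  have hL := h.lip_nonneg
  have hD := h.diam_pos.le
  set P := gaussDataLaw n d v 𝒟
  have hFint := integrable_comp_randTraj (η := η) (v := v) h hx₁ hn
    (abs_sub_le_of_add_inner_le (fun x hx => h.norm_popGrad_le hM hx) hF) (n - 1)
  -- On `K` the population gradient is at most `‖∇f(u)‖ + LD`; the drift of the query points adds
  -- `2LD`.
  set B := ‖popGrad g 𝒟 u‖ + L * D + 2 * L * D
  have hsucc : n - 1 + 1 = n := by omega
  have hpt : ∀ ω, (n : ℝ) * (n + 1) / 2 * (F (randTraj hn K g x₁ η ω (n - 1)).x - F u)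
      ≤ ((n : ℝ) * (B * D) + D ^ 2 / (2 * η))
        + η / 2 * ∑ k ∈ Finset.range n, ‖noiseStream hn ω.2 k‖ ^ 2
        + D * ∑ k ∈ Finset.range n, ‖estError hn K g 𝒟 x₁ η k ω‖
        - ∑ k ∈ Finset.range n, inner ℝ ((randTraj hn K g x₁ η ω k).w - u)
          (noiseStream hn ω.2 k) := by
    intro ω
    -- Position `n - 1` holds `x_n`. The sums run over rounds `0` to `n - 1`, where no padded data
    -- or noise occurs.
    have hgap := weighted_gap_le (K := K) (D := D) (B := B) (η := η) hη (by positivity) h.diam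
      (F := F) (dF := popGrad g 𝒟) hF (x := fun k => (randTraj hn K g x₁ η ω k).x)
      (w := fun k => (randTraj hn K g x₁ η ω k).w)
      (q := aggEst g (dataStream hn ω.1) (randTraj hn K g x₁ η ω)) (y := noiseStream hn ω.2)
      (fun k => (randTraj_mem h hx₁ hn ω k).2) (fun k => (randTraj_mem h hx₁ hn ω k).1) rfl
      (fun k => traj_x_succ k) (fun k => ?_) (fun k u hu => ?_) hu (n - 1)
    · rw [hsucc] at hgap
      have hc : ((n - 1 : ℕ) : ℝ) = n - 1 := by
        rw [Nat.cast_sub (by omega)]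
        simp
      rw [hc, show (n : ℝ) - 1 + 1 = n by ring, show (n : ℝ) - 1 + 2 = n + 1 by ring] at hgap
      exact hgap
    · have := norm_smul_sub_smul_le_of_lipschitz (g := g) (η := η) (z := dataStream hn ω.1)
        (y := noiseStream hn ω.2) h.compact h.convex hx₁ hL h.diam (φ := popGrad g 𝒟)
        (G := ‖popGrad g 𝒟 u‖ + L * D) (fun x hx => ?_)
        (fun x hx y hy => h.norm_popGrad_sub_le hM hx hy) k
      · rw [traj_xPrev] at this
        exact this
      · have h1 := (h.norm_popGrad_sub_le hM hx hu).trans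
          (mul_le_mul_of_nonneg_left (h.diam x hx u hu) hL)
        have h2 := norm_le_norm_add_norm_sub' (popGrad g 𝒟 x) (popGrad g 𝒟 u)
        linarith
    · simp only [randTraj, traj_w_succ]
      exact inner_sub_euclProj_nonpos h.compact h.convex ⟨x₁, hx₁⟩ _ hu
  have i1 : Integrable (fun ω : (∀ i, Fin n → Z i) × (Fin n → Vec d) =>
      ∑ k ∈ Finset.range n, ‖noiseStream hn ω.2 k‖ ^ 2) P :=
    integrable_finsetSum _ fun k _ => (memLp_noiseStream hn k).norm.integrable_sq
  have i2 : Integrable (fun ω => ∑ k ∈ Finset.range n, ‖estError hn K g 𝒟 x₁ η k ω‖) P :=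
    integrable_finsetSum _ fun k _ =>
      (MemLp.integrable (by norm_num) (memLp_estError (v := v) h hx₁ hn k)).norm
  have i3 : Integrable (fun ω => ∑ k ∈ Finset.range n,
      inner ℝ ((randTraj hn K g x₁ η ω k).w - u) (noiseStream hn ω.2 k)) P :=
    integrable_finsetSum _ fun k _ => integrable_inner_noise h hx₁ hn hu k
  have e1 : ∫ ω, ∑ k ∈ Finset.range n, ‖noiseStream hn ω.2 k‖ ^ 2 ∂P = n * (d * v) := by
    rw [integral_finsetSum _ fun k _ => (memLp_noiseStream hn k).norm.integrable_sq]
    simp [integral_norm_noiseStream_sq]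
  have e2 : ∫ ω, ∑ k ∈ Finset.range n, ‖estError hn K g 𝒟 x₁ η k ω‖ ∂P
      ≤ n * (√n * (σ + 2 * σL * D) / √M) := by
    rw [integral_finsetSum _ fun k _ =>
      (MemLp.integrable (by norm_num) (memLp_estError (v := v) h hx₁ hn k)).norm]
    refine (Finset.sum_le_card_nsmul _ _ _ fun k hk => integral_norm_estError_le h hx₁ hM hn
      (Finset.mem_range.1 hk)).trans (le_of_eq ?_)
    rw [Finset.card_range, nsmul_eq_mul]
  have e3 : ∫ ω, ∑ k ∈ Finset.range n,
      inner ℝ ((randTraj hn K g x₁ η ω k).w - u) (noiseStream hn ω.2 k) ∂P = 0 := by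
    rw [integral_finsetSum _ fun k _ => integrable_inner_noise h hx₁ hn hu k]
    exact Finset.sum_eq_zero fun k hk =>
      integral_inner_noise h hx₁ hn hu (Finset.mem_range.1 hk)
  have ic : Integrable (fun _ : (∀ i, Fin n → Z i) × (Fin n → Vec d) =>
      (n : ℝ) * (B * D) + D ^ 2 / (2 * η)) P := integrable_const _
  have i12 := ic.add (i1.const_mul (η / 2))
  have i123 := i12.add (i2.const_mul D)
  have hmono := integral_mono ((hFint.sub (integrable_const (F u))).const_mul
    ((n : ℝ) * (n + 1) / 2)) (i123.sub i3) hpt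
  simp only [Pi.sub_apply, Pi.add_apply] at hmono
  rw [integral_const_mul, integral_sub hFint (integrable_const _),
    integral_sub (by exact i123) i3, integral_add (by exact i12) (i2.const_mul D),
    integral_add ic (i1.const_mul _), integral_const_mul, integral_const_mul, e1, e3] at hmono
  simp only [integral_const, probReal_univ, one_smul, sub_zero] at hmono
  have hB : B = ‖popGrad g 𝒟 u‖ + 3 * L * D := by simp only [B]; ring
  rw [hB] at hmono
  have := mul_le_mul_of_nonneg_left e2 hD
  linarith

end Convergence

/-! ### Constants and assembly -/

theorem gap_le_of_weighted_gap_le {n M r D S ρ γ L τ a η v : ℝ} (hn : 0 < n) (hM : 0 < M)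
    (hr : 0 < r) (hD : 0 < D) (hS : 0 < S) (hρ : 0 < ρ) (hγ : 0 ≤ γ) (hL : 0 ≤ L) (hτ : 0 ≤ τ)
    (hη : η = D * ρ * M / (2 * S * n * r)) (hv : v = 4 * S ^ 2 * n / (ρ ^ 2 * M ^ 2))
    (h : n * (n + 1) / 2 * a ≤ n * ((γ + 3 * L * D) * D) + D ^ 2 / (2 * η)
      + η / 2 * (n * (r ^ 2 * v)) + D * (n * (√n * τ / √M))) :
    a ≤ 4 * D * ((γ + 2 * L * D) / n + τ / √(n * M) + S * r / (ρ * n * M)) := by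
  have hsn : 0 < √n := Real.sqrt_pos.2 hn
  have hsM : 0 < √M := Real.sqrt_pos.2 hM
  -- The learning rate balances the regret term and the noise term: `e1` and `e2` have the same
  -- value. In the final comparison `3n ≤ 4(n + 1)` absorbs the terms in `L D²`.
  have e1 : D ^ 2 / (2 * η) = n * (D * S * r / (ρ * M)) := by
    rw [hη]
    field_simp
  have e2 : η / 2 * (n * (r ^ 2 * v)) = n * (D * S * r / (ρ * M)) := by
    rw [hη, hv]
    field_simp
    ring
  have e3 : n * (n + 1) / 2 * (4 * D * ((γ + 2 * L * D) / n + τ / √(n * M)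
      + S * r / (ρ * n * M)))
      = 2 * (n + 1) * (D * (γ + 2 * L * D)) + 2 * (n + 1) * (D * (√n * τ / √M))
        + 2 * (n + 1) * (D * S * r / (ρ * M)) := by
    have e4 : τ / √(n * M) = √n * τ / √M / n := by
      rw [Real.sqrt_mul hn.le]
      field_simp
      rw [Real.sq_sqrt hn.le]
    rw [e4]
    field_simp
    ring
  have hp : 0 < n * (n + 1) / 2 := by positivity
  refine le_of_mul_le_mul_left (h.trans ?_) hp
  rw [e1, e2, e3]
  have p1 : 0 ≤ D * S * r / (ρ * M) := by positivity
  have p2 : 0 ≤ D * (√n * τ / √M) := by positivity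
  have p3 : 0 ≤ D * γ := by positivity
  have p4 : 0 ≤ D * (L * D) := by positivity
  nlinarith [mul_nonneg hn.le p2, mul_nonneg hn.le p3, mul_nonneg hn.le p4]

theorem particular_rate_le {n M r D S γ L τ G ε l : ℝ} {ρ : ℝ} (hM : 0 < M) (hMn : M ≤ n)
    (hD : 0 < D) (hL : 0 ≤ L) (hγ : γ ≤ G) (hγ0 : 0 ≤ γ) (hS : S = G + 2 * L * D) (hl : 0 < l)
    (hε : 0 < ε) (hr : 0 ≤ r) (hρ : ρ = ε / (2 * √l)) :
    4 * D * ((γ + 2 * L * D) / n + τ / √(n * M) + S * √r / (ρ * n * M))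
      ≤ 4 * D * ((S + τ) / √(n * M) + 2 * S * √(r * l) / (ε * n * M)) := by
  have hn : 0 < n := hM.trans_le hMn
  have hsl : 0 < √l := Real.sqrt_pos.2 hl
  have hnM : √(n * M) ≤ n := by
    rw [Real.sqrt_le_left hn.le]
    nlinarith
  have h1 : (γ + 2 * L * D) / n ≤ S / √(n * M) := by
    have : 0 < √(n * M) := Real.sqrt_pos.2 (by positivity)
    have : 0 ≤ γ + 2 * L * D := by positivity
    exact div_le_div₀ (by linarith) (by linarith) (by positivity) hnM
  have h2 : S * √r / (ρ * n * M) = 2 * S * √(r * l) / (ε * n * M) := by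
    rw [hρ, Real.sqrt_mul hr]
    field_simp
  rw [h2, add_div S τ]
  gcongr

theorem mainTheorem2 {d M n : ℕ} (hM : 0 < M) (hn : 0 < n)
    {Z : Fin M → Type*} [∀ i, MeasurableSpace (Z i)]
    (K : Set (Vec d)) (hKc : IsCompact K) (hKconv : Convex ℝ K)
    (D G L : ℝ) (hD : 0 < D) (hG : 0 < G) (hL : 0 < L)
    (hdiam : ∀ x ∈ K, ∀ y ∈ K, ‖x - y‖ ≤ D)
    -- the losses `f_i(x; z)` and their gradients `g_i(x; z) = ∇f_i(x; z)` in `x ∈ K`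
    (f : ∀ i, Vec d → Z i → ℝ) (g : ∀ i, Vec d → Z i → Vec d)
    (hgrad : ∀ i z, ∀ x ∈ K, HasGradientWithinAt (fun y => f i y z) (g i x z) K x)
    (hLip : ∀ i z, ∀ x ∈ K, ∀ y ∈ K, |f i x z - f i y z| ≤ G * ‖x - y‖)
    -- automatic from `hLip` if `K` has an interior point
    (hgG : ∀ i z, ∀ x ∈ K, ‖g i x z‖ ≤ G)
    (hsmooth : ∀ i z, ∀ x ∈ K, ∀ y ∈ K, ‖g i x z - g i y z‖ ≤ L * ‖x - y‖)
    (x₁ : Vec d) (hx₁ : x₁ ∈ K)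
    (S : ℝ) (hS : S = G + 2 * L * D) :
    -- privacy, for arbitrary datasets and without convexity of the losses
    (∀ ρ : ℝ, 0 < ρ → ∀ δ : ℝ, 0 < δ → δ < 1 →
      IsDPForEachMachine K g x₁ (learningRate d M n D S ρ) (noiseLaw d M n S ρ)
        (ρ ^ 2 / 2 + ρ * √(2 * Real.log (1 / δ))) δ) ∧
    (∀ ε δ ρ : ℝ, 0 < δ → δ < 1 → 0 < ε → ε ≤ Real.log (1 / δ) →
      ρ = ε / (2 * √(Real.log (1 / δ))) →
      IsDPForEachMachine K g x₁ (learningRate d M n D S ρ) (noiseLaw d M n S ρ) ε δ) ∧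
    -- convergence, for arbitrary (possibly different) distributions of the machines
    (∀ (𝒟 : ∀ i, Measure (Z i)) [∀ i, IsProbabilityMeasure (𝒟 i)] (σ σL : ℝ),
      (∀ i, ∀ᵐ z ∂(𝒟 i), ConvexOn ℝ K (fun x => f i x z)) →
      (∀ i, ∀ x ∈ K, Integrable (fun z => f i x z) (𝒟 i)) →
      (∀ i, ∀ x ∈ K, Measurable (fun z => g i x z)) →
      0 ≤ σ → 0 ≤ σL →
      (∀ i, ∀ x ∈ K, ∫ z, ‖g i x z - machineGrad g 𝒟 i x‖ ^ 2 ∂(𝒟 i) ≤ σ ^ 2) →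
      (∀ i, ∀ x ∈ K, ∀ y ∈ K,
        ∫ z, ‖(g i x z - machineGrad g 𝒟 i x) - (g i y z - machineGrad g 𝒟 i y)‖ ^ 2 ∂(𝒟 i)
          ≤ σL ^ 2 * ‖x - y‖ ^ 2) →
      ∀ xs ∈ K, IsMinOn (popLoss f 𝒟) K xs →
        (∀ ρ : ℝ, 0 < ρ →
          Integrable (fun ω : (∀ i, Fin n → Z i) × (Fin n → Vec d) =>
              popLoss f 𝒟 (flOutput K g x₁ (learningRate d M n D S ρ) ω.1 ω.2))
            (dataNoiseLaw n 𝒟 (noiseLaw d M n S ρ)) ∧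
          (∫ ω : (∀ i, Fin n → Z i) × (Fin n → Vec d),
              popLoss f 𝒟 (flOutput K g x₁ (learningRate d M n D S ρ) ω.1 ω.2)
            ∂(dataNoiseLaw n 𝒟 (noiseLaw d M n S ρ))) - popLoss f 𝒟 xs
            ≤ 4 * D * ((‖popGrad g 𝒟 xs‖ + 2 * L * D) / n + (σ + 2 * σL * D) / √(n * M)
                + S * √d / (ρ * n * M))) ∧
        (∀ ε δ ρ : ℝ, 0 < δ → δ < 1 → 0 < ε → ε ≤ Real.log (1 / δ) →
          ρ = ε / (2 * √(Real.log (1 / δ))) → M ≤ n →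
          (∫ ω : (∀ i, Fin n → Z i) × (Fin n → Vec d),
              popLoss f 𝒟 (flOutput K g x₁ (learningRate d M n D S ρ) ω.1 ω.2)
            ∂(dataNoiseLaw n 𝒟 (noiseLaw d M n S ρ))) - popLoss f 𝒟 xs
            ≤ 4 * D * ((S + σ + 2 * σL * D) / √(n * M)
                + 2 * S * √(d * Real.log (1 / δ)) / (ε * n * M)))) ∧
    -- computational cost, linear in the total number `n * M` of samples
    (∀ (η : ℝ) (A : ∀ i, Fin n → Z i) (Y : Fin n → Vec d),
      flCost K g x₁ η A Y Op.grad = 2 * (n * M) ∧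
      flCost K g x₁ η A Y Op.project = n ∧
      flCost K g x₁ η A Y Op.draw = n ∧
      flCost K g x₁ η A Y Op.vec ≤ 8 * (n * M)) := by
  have hS0 : 0 < S := by rw [hS]; positivity
  have hpriv : ∀ ρ : ℝ, 0 < ρ → ∀ δ : ℝ, 0 < δ → δ < 1 →
      IsDPForEachMachine K g x₁ (learningRate d M n D S ρ) (noiseLaw d M n S ρ)
        (ρ ^ 2 / 2 + ρ * √(2 * Real.log (1 / δ))) δ := fun ρ hρ δ hδ hδ1 =>
    queryPoints_isDP hM hn hKc hKconv hG hL hD hdiam hgG hsmooth hx₁ hS hρ hδ hδ1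
  refine ⟨hpriv, ?_, ?_, fun η A Y => flCost_bounds hM A Y⟩
  · intro ε δ ρ hδ hδ1 hε hεl hρ i A
    have hρ0 : 0 < ρ := by
      have := Real.sqrt_pos.2 (hε.trans_le hεl)
      rw [hρ]
      positivity
    exact (hpriv ρ hρ0 δ hδ hδ1 i A).mono (privacy_budget_le hε hεl hρ)
  · intro 𝒟 _ σ σL hconv hint hmeas hσ hσL hvar hlipvar xs hxs _
    have hmodel : StochasticGradientModel K g 𝒟 D G L σ σL :=
      ⟨hKc, hKconv, hD, hG.le, hL.le, hσ, hσL, hdiam, hgG, hsmooth, hmeas, hvar, hlipvar⟩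
    have hM' : (0 : ℝ) < M := by exact_mod_cast hM
    have hn' : (0 : ℝ) < n := by exact_mod_cast hn
    have hτ : 0 ≤ σ + 2 * σL * D := by positivity
    have hfirst : ∀ u ∈ K, ∀ w ∈ K,
        popLoss f 𝒟 u + inner ℝ (popGrad g 𝒟 u) (w - u) ≤ popLoss f 𝒟 w :=
      fun u hu w hw => popLoss_add_inner_le hmodel hgrad hconv hint hu hw
    have hout : ∀ (η : ℝ) (ω : (∀ i, Fin n → Z i) × (Fin n → Vec d)),
        flOutput K g x₁ η ω.1 ω.2 = (randTraj hn K g x₁ η ω (n - 1)).x := by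
      intro η ω
      rw [flOutput, runRounds_val hn]
      rfl
    have hrate : ∀ ρ : ℝ, 0 < ρ →
        Integrable (fun ω : (∀ i, Fin n → Z i) × (Fin n → Vec d) =>
            popLoss f 𝒟 (flOutput K g x₁ (learningRate d M n D S ρ) ω.1 ω.2))
          (dataNoiseLaw n 𝒟 (noiseLaw d M n S ρ)) ∧
        (∫ ω : (∀ i, Fin n → Z i) × (Fin n → Vec d),
            popLoss f 𝒟 (flOutput K g x₁ (learningRate d M n D S ρ) ω.1 ω.2)
          ∂(dataNoiseLaw n 𝒟 (noiseLaw d M n S ρ))) - popLoss f 𝒟 xs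
          ≤ 4 * D * ((‖popGrad g 𝒟 xs‖ + 2 * L * D) / n + (σ + 2 * σL * D) / √(n * M)
              + S * √d / (ρ * n * M)) := by
      intro ρ hρ
      simp only [hout]
      refine ⟨integrable_comp_randTraj (v := noiseVar M n S ρ) hmodel hx₁ hn
        (abs_sub_le_of_add_inner_le (fun x hx => hmodel.norm_popGrad_le hM hx) hfirst) _, ?_⟩
      -- For `d = 0` the learning rate is `0` and the regret bound does not apply, but the space is
      -- a single point and the gap vanishes.
      rcases Nat.eq_zero_or_pos d with rfl | hd
      · have hprob : IsProbabilityMeasure (dataNoiseLaw n 𝒟 (noiseLaw 0 M n S ρ)) :=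
          inferInstanceAs (IsProbabilityMeasure (gaussDataLaw n 0 (noiseVar M n S ρ) 𝒟))
        have e : ∀ ω, (randTraj hn K g x₁ (learningRate 0 M n D S ρ) ω (n - 1)).x = xs :=
          fun ω => Subsingleton.elim _ _
        simp only [e, integral_const, probReal_univ, one_smul, sub_self]
        positivity
      · have hr : 0 < √(d : ℝ) := Real.sqrt_pos.2 (by exact_mod_cast hd)
        have hη : 0 < learningRate d M n D S ρ := by
          rw [learningRate]
          positivity
        have hgap := expected_gap_le (v := noiseVar M n S ρ) hmodel hx₁ hM hn hη hfirst hxs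
        refine gap_le_of_weighted_gap_le (r := √(d : ℝ)) (v := (noiseVar M n S ρ : ℝ)) hn' hM' hr hD
          hS0 hρ (norm_nonneg (popGrad g 𝒟 xs)) hL.le hτ (η := learningRate d M n D S ρ) rfl
          (Real.coe_toNNReal _ (by positivity)) ?_
        rw [Real.sq_sqrt (by positivity)]
        exact hgap
    refine ⟨hrate, ?_⟩
    intro ε δ ρ hδ hδ1 hε hεl hρ hMn
    have hl : 0 < Real.log (1 / δ) := hε.trans_le hεl
    have hρ0 : 0 < ρ := by
      have := Real.sqrt_pos.2 hl
      rw [hρ]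
      positivity
    refine (hrate ρ hρ0).2.trans ((particular_rate_le hM' (by exact_mod_cast hMn) hD hL.le
      (hmodel.norm_popGrad_le hM hxs) (norm_nonneg _) hS hl hε (by positivity) hρ).trans
      (le_of_eq ?_))
    rw [add_assoc S]
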